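/- All Hilbert spaces are complex and of arbitrary dimension; $\dim$ denotes Hilbert space dimension (the cardinality of an orthonormal basis). Let $E$ be a linear subspace of a Hilbert space and let $\bar E$ be its closure. Put $$\mathrm{IC}(E)=\min\{\dim(\bar E\ominus V): V \text{ is a complete linear subspace of } E\},$$ where $\bar E\ominus V$ is the orthogonal complement of $V$ in $\bar E$, and let $b(E)=1$ if $E$ contains a linear subspace that is linearly homeomorphic to $\bar E$, and $b(E)=0$ otherwise. For a bounded linear operator $A\colon H\to K$ between Hilbert spaces, with kernel $N(A)$ and range $R(A)$, define $$\iota_r(A)=\dim\overline{R(A)},\qquad \iota_i(A)=\dim N(A)+\mathrm{IC}(R(A)),$$ $$\iota_f(A)=\dim\bigl(K\ominus\overline{R(A)}\bigr)+\mathrm{IC}(R(A)),\qquad \iota_b(A)=b(R(A)).$$ Let $GL(H)$ and $GL(K)$ be the groups of all linear homeomorphisms of $H$ and of $K$ onto themselves. Theorem. Let $H$ and $K$ be Hilbert spaces and let $A\colon H\to K$ be a bounded linear operator. The closure, in the operator norm, of the orbit $\{GAL^{-1}: L\in GL(H),\ G\in GL(K)\}$ consists precisely of those bounded linear operators $C\colon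 H\to K$ which satisfy the following three conditions: (a) $\iota_r(C)\le\iota_r(A)$; (b) if $\iota_b(A)=0$ and $\iota_b(C)=1$, then $\iota_r(C)<\iota_r(A)$; (c) there is a cardinal $\alpha$ for which $\iota_i(C)=\iota_i(A)+\alpha$ and $\iota_f(C)=\iota_f(A)+\alpha$. Moreover, if a bounded linear operator $C\colon H\to K$ satisfies $\iota_i(C)=\dim H$ and $\iota_f(C)=\dim K$, then (c) is fulfilled for every bounded linear operator $A\colon H\to K$. -/

import Mathlib

universe u v

noncomputable section

/-- The Hilbert space dimension: the cardinality of an orthonormal (Hilbert) basis. All Hilbert bases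
of `E` have the same cardinality (`HilbertOrbit.mk_eq_hilbertDim` below), and one exists whenever `E`
is complete; the notion is used for complete spaces only. -/
def HilbertOrbit.hilbertDim (E : Type u) [NormedAddCommGroup E] [InnerProductSpace ℂ E] :
    Cardinal.{u} :=
  sInf {c | ∃ ι : Type u, Nonempty (HilbertBasis ι ℂ E) ∧ Cardinal.mk ι = c}

theorem HilbertOrbit.mk_le_of_infinite {E ι κ : Type u} [NormedAddCommGroup E]
    [InnerProductSpace ℂ E] [Infinite ι] (b : HilbertBasis ι ℂ E) (b' : HilbertBasis κ ℂ E) :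
    Cardinal.mk κ ≤ Cardinal.mk ι := by
  have hs : ∀ i : ι, {k : κ | b'.repr (b i) k ≠ 0}.Countable := fun i =>
    ((b'.hasSum_repr (b i)).summable.countable_support).mono (fun k hk => by
      simp only [Function.mem_support]
      exact smul_ne_zero hk (b'.orthonormal.ne_zero k))
  have hcov : (Set.univ : Set κ) ⊆ ⋃ i : ι, {k : κ | b'.repr (b i) k ≠ 0} := by
    intro k _
    by_contra hk
    simp only [Set.mem_iUnion, Set.mem_ofPred_eq, not_exists, not_not] at hk
    apply b'.orthonormal.ne_zero k
    have h0 : b.repr (b' k) = 0 := by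
      ext i
      have h1 := hk i
      rw [b'.repr_apply_apply] at h1
      rw [b.repr_apply_apply, ← inner_conj_symm, h1]
      simp
    exact (LinearIsometryEquiv.map_eq_zero_iff _).1 h0
  calc Cardinal.mk κ = Cardinal.mk (Set.univ : Set κ) := Cardinal.mk_univ.symm
    _ ≤ Cardinal.mk (⋃ i : ι, {k : κ | b'.repr (b i) k ≠ 0}) := Cardinal.mk_le_mk_of_subset hcov
    _ ≤ Cardinal.mk ι * ⨆ i : ι, Cardinal.mk {k : κ | b'.repr (b i) k ≠ 0} :=
        Cardinal.mk_iUnion_le _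
    _ ≤ Cardinal.mk ι * Cardinal.aleph0 := by
        gcongr
        exact ciSup_le' fun i => (hs i).le_aleph0
    _ = Cardinal.mk ι := Cardinal.mul_aleph0_eq (Cardinal.aleph0_le_mk ι)

theorem HilbertOrbit.mk_eq_mk {E ι κ : Type u} [NormedAddCommGroup E]
    [InnerProductSpace ℂ E] (b : HilbertBasis ι ℂ E) (b' : HilbertBasis κ ℂ E) :
    Cardinal.mk ι = Cardinal.mk κ := by
  have key : ∀ {ι κ : Type u}, Finite ι → HilbertBasis ι ℂ E → HilbertBasis κ ℂ E →
      Finite κ := by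
    intro ι κ hι b b'
    have := Fintype.ofFinite ι
    have : FiniteDimensional ℂ E := b.toOrthonormalBasis.toBasis.finiteDimensional_of_finite
    exact b'.orthonormal.linearIndependent.finite
  rcases finite_or_infinite ι with hι | hι
  · have hκ := key hι b b'
    have := Fintype.ofFinite ι
    have := Fintype.ofFinite κ
    exact Cardinal.mk_congr (b.toOrthonormalBasis.toBasis.indexEquiv b'.toOrthonormalBasis.toBasis)
  · have hκ : Infinite κ := by
      by_contra h
      have := key (not_infinite_iff_finite.1 h) b' b
      exact not_finite ι
    exact le_antisymm (mk_le_of_infinite b' b) (mk_le_of_infinite b b')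

/-- Every Hilbert basis computes the dimension. -/
theorem HilbertOrbit.mk_eq_hilbertDim {E ι : Type u} [NormedAddCommGroup E]
    [InnerProductSpace ℂ E] (b : HilbertBasis ι ℂ E) :
    Cardinal.mk ι = hilbertDim E := by
  obtain ⟨κ, ⟨b'⟩, h⟩ := csInf_mem (s := {c | ∃ ι : Type u, Nonempty (HilbertBasis ι ℂ E) ∧
    Cardinal.mk ι = c}) ⟨_, ι, ⟨b⟩, rfl⟩
  exact (mk_eq_mk b b').trans h

namespace HilbertOrbit

/-- The index of incompleteness `IC(E)` of a linear subspace `E` of a Hilbert space: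
the least value of `dim (Ē ⊖ V)` over the complete subspaces `V` of `E`. Here the completion `Ē` is
realised as the closure of `E`, and `Ē ⊖ V` is `Vᗮ ⊓ Ē`. -/
def incompletenessIndex {K : Type v} [NormedAddCommGroup K] [InnerProductSpace ℂ K]
    (E : Submodule ℂ K) : Cardinal.{v} :=
  sInf {c | ∃ V : Submodule ℂ K, V ≤ E ∧ IsComplete (V : Set K) ∧
    hilbertDim ↥(Vᗮ ⊓ E.topologicalClosure) = c}

open Classical in
/-- The binary index `b(E)` of a linear subspace `E` of a Hilbert space: it is `1` if `E` contains
a linear subspace that is isomorphic (linearly homeomorphic) to the completion `Ē`, else `0`. -/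
def binaryIndex {K : Type v} [NormedAddCommGroup K] [InnerProductSpace ℂ K]
    (E : Submodule ℂ K) : ℕ :=
  if ∃ V : Submodule ℂ K, V ≤ E ∧ Nonempty (V ≃L[ℂ] E.topologicalClosure) then 1 else 0

variable {H : Type u} {K : Type v} [NormedAddCommGroup H] [InnerProductSpace ℂ H]
  [NormedAddCommGroup K] [InnerProductSpace ℂ K]

/-- The range `R(A)` as a linear subspace of `K`. -/
def ran (A : H →L[ℂ] K) : Submodule ℂ K := LinearMap.range (A : H →ₗ[ℂ] K)

/-- The kernel `N(A)` as a linear subspace of `H`. -/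
def nul (A : H →L[ℂ] K) : Submodule ℂ H := LinearMap.ker (A : H →ₗ[ℂ] K)

/-- The range index: the dimension of the closure of the range. -/
def rangeIndex (A : H →L[ℂ] K) : Cardinal.{max u v} :=
  Cardinal.lift.{u} (hilbertDim (ran A).topologicalClosure)

/-- The initial index: `dim N(A) + IC(R(A))`. -/
def initialIndex (A : H →L[ℂ] K) : Cardinal.{max u v} :=
  Cardinal.lift.{v} (hilbertDim (nul A)) + Cardinal.lift.{u} (incompletenessIndex (ran A))

/-- The final index: `dim (K ⊖ closure of R(A)) + IC(R(A))`. -/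
def finalIndex (A : H →L[ℂ] K) : Cardinal.{max u v} :=
  Cardinal.lift.{u} (hilbertDim ↥((ran A).topologicalClosureᗮ)) +
    Cardinal.lift.{u} (incompletenessIndex (ran A))

/-- The binary index of an operator: that of its range. -/
def opBinaryIndex (A : H →L[ℂ] K) : ℕ := binaryIndex (ran A)

/-- The orbit `{G A L⁻¹ : L ∈ GL(H), G ∈ GL(K)}`, for the groups of all linear homeomorphisms. -/
def orbit (A : H →L[ℂ] K) : Set (H →L[ℂ] K) :=
  {T | ∃ (L : H ≃L[ℂ] H) (G : K ≃L[ℂ] K),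
    T = (G : K →L[ℂ] K) ∘L A ∘L (L.symm : H →L[ℂ] H)}

end HilbertOrbit

end

universe w

/-! Everything is read off from closed subspaces V of R(A). Put s = dim V and let t be the
codimension of V in the closure of R(A). Then s + t = ι_r(A), IC(R(A)) is the least possible t, and
ι_b(A) = 1 exactly when some V has s = ι_r(A).

Each such V equals A X for a closed X on which A is bounded below, and then dim X^⊥ = dim N(A) + t
(`lift_hilbertDim_orthogonal`), while dim (A X)^⊥ = dim R(A)^⊥ + t. Boundedness below on X survives
small perturbations, and so do these two codimensions. Hence, if C lies in the closure of the orbit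
of A, every pair (s, t) for C yields a pair (s, t') for A with the same two sums
(`HasSplit.exists_of_norm_sub_lt`). Choosing s beyond any cardinal below ι_r(C), then s = ι_r(C),
then t = IC(R(C)), gives (a), (b) and (c).

Conversely, cut C spectrally: C is bounded below on X and of norm at most ε on X^⊥, so C is within ε
of C P_X. If A has a subspace Y with matching dimensions, homeomorphisms L and G turn A P_Y into C
P_X, and A P_Y is the limit of A (P_Y + z P_{Y^⊥}) as z tends to 0
(`exists_hasSplit_mem_closure_orbit`). That (a), (b) and (c) provide such a Y is cardinal arithmetic
(`exists_hasSplit_add_eq`). -/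

namespace HilbertOrbit

open Cardinal

/-! ### Hilbert space dimension -/

section Dimension

variable {E : Type u} {F : Type v} [NormedAddCommGroup E] [InnerProductSpace ℂ E]
  [NormedAddCommGroup F] [InnerProductSpace ℂ F]

theorem exists_hilbertBasis_type [CompleteSpace E] :
    ∃ ι : Type u, Nonempty (HilbertBasis ι ℂ E) := by
  obtain ⟨s, b, -⟩ := exists_hilbertBasis ℂ E
  exact ⟨s, ⟨b⟩⟩

theorem hilbertBasis_eq_zero {ι : Type*} (b : HilbertBasis ι ℂ E) {x : E}
    (hx : ∀ i, inner ℂ (b i) x = 0) : x = 0 := by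
  rw [← LinearIsometryEquiv.map_eq_zero_iff b.repr]
  ext i
  rw [b.repr_apply_apply, hx i]
  simp

/-- An orthonormal family whose orthogonal complement is trivial computes the dimension. -/
theorem mk_eq_hilbertDim_of_total [CompleteSpace E] {ι : Type u} {b : ι → E}
    (hb : Orthonormal ℂ b) (ht : ∀ x, (∀ i, inner ℂ (b i) x = 0) → x = 0) :
    #ι = hilbertDim E := by
  refine mk_eq_hilbertDim (HilbertBasis.mkOfOrthogonalEqBot hb ?_)
  rw [Submodule.eq_bot_iff]
  intro x hx
  exact ht x fun i => (Submodule.mem_orthogonal _ _).1 hx _ (Submodule.subset_span ⟨i, rfl⟩)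

/-- Each `e j` has countable support in a Hilbert basis of `F`, and totality makes these supports
cover the index set, which therefore injects into `J × ℕ`. -/
theorem lift_hilbertDim_le_of_total [CompleteSpace F] {J : Type w} (e : J → F)
    (he : ∀ y, (∀ j, inner ℂ (e j) y = 0) → y = 0) :
    lift.{w} (hilbertDim F) ≤ lift.{v} #J * ℵ₀ := by
  obtain ⟨κ, ⟨b⟩⟩ := exists_hilbertBasis_type (E := F)
  rw [← mk_eq_hilbertDim b]
  have hs : ∀ j : J, {k : κ | b.repr (e j) k ≠ 0}.Countable := fun j =>
    ((b.hasSum_repr (e j)).summable.countable_support).mono (fun k hk => by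
      simp only [Function.mem_support]
      exact smul_ne_zero hk (b.orthonormal.ne_zero k))
  have hcov : ∀ k : κ, ∃ j : J, b.repr (e j) k ≠ 0 := by
    intro k
    by_contra! hk
    refine b.orthonormal.ne_zero k (he _ fun j => ?_)
    have := hk j
    rw [b.repr_apply_apply] at this
    rw [← inner_conj_symm, this, map_zero]
  choose j hj using hcov
  have henc : ∀ i : J, ∃ f : {k : κ | b.repr (e i) k ≠ 0} → ℕ, Function.Injective f :=
    fun i => (Set.countable_iff_exists_injective).1 (hs i)
  choose f hf using henc
  have hinj : Function.Injective (fun k : κ => (j k, f (j k) ⟨k, hj k⟩)) := by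
    intro k l hkl
    have h1 : j k = j l := congrArg Prod.fst hkl
    have h2 : f (j k) ⟨k, hj k⟩ = f (j l) ⟨l, hj l⟩ := congrArg Prod.snd hkl
    have h3 : ∀ i (hi : i = j l) (hk : b.repr (e i) k ≠ 0),
        f i ⟨k, hk⟩ = f (j l) ⟨l, hj l⟩ → k = l := by
      rintro i rfl hk h
      exact congrArg Subtype.val (hf _ h)
    exact h3 _ h1 (hj k) h2
  have := Cardinal.lift_mk_le_lift_mk_of_injective hinj
  simpa [Cardinal.mk_prod] using this

theorem hilbertDim_eq_finrank [FiniteDimensional ℂ E] :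
    hilbertDim E = (Module.finrank ℂ E : Cardinal.{u}) := by
  rw [← mk_eq_hilbertDim
    ((stdOrthonormalBasis ℂ E).reindex Equiv.ulift.{u}.symm).toHilbertBasis]
  simp

theorem finiteDimensional_of_hilbertDim_lt [CompleteSpace E] (h : hilbertDim E < ℵ₀) :
    FiniteDimensional ℂ E := by
  obtain ⟨ι, ⟨b⟩⟩ := exists_hilbertBasis_type (E := E)
  rw [← mk_eq_hilbertDim b] at h
  have := Cardinal.lt_aleph0_iff_finite.1 h
  have := Fintype.ofFinite ι
  exact b.toOrthonormalBasis.toBasis.finiteDimensional_of_finite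

/-- A bounded operator with dense range does not increase the dimension. -/
theorem lift_hilbertDim_le_of_dense [CompleteSpace E] [CompleteSpace F] (A : E →L[ℂ] F)
    (hA : ∀ y, (∀ x, inner ℂ (A x) y = 0) → y = 0) :
    lift.{u} (hilbertDim F) ≤ lift.{v} (hilbertDim E) := by
  -- The counting bound loses a factor ℵ₀, so finite dimension needs linear algebra instead.
  rcases lt_or_ge (hilbertDim E) ℵ₀ with h | h
  · have := finiteDimensional_of_hilbertDim_lt h
    have hfin : FiniteDimensional ℂ (LinearMap.range (A : E →ₗ[ℂ] F)) := inferInstance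
    have htop : LinearMap.range (A : E →ₗ[ℂ] F) = ⊤ := by
      rw [← Submodule.orthogonal_eq_bot_iff, Submodule.eq_bot_iff]
      intro y hy
      exact hA y fun x => (Submodule.mem_orthogonal _ _).1 hy _ ⟨x, rfl⟩
    have hsurj : Function.Surjective (A : E →ₗ[ℂ] F) := LinearMap.range_eq_top.1 htop
    have : FiniteDimensional ℂ F := Module.Finite.of_surjective _ hsurj
    rw [hilbertDim_eq_finrank, hilbertDim_eq_finrank]
    rw [Cardinal.lift_natCast, Cardinal.lift_natCast, Nat.cast_le]
    exact LinearMap.finrank_le_finrank_of_surjective hsurj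
  · obtain ⟨ι, ⟨b⟩⟩ := exists_hilbertBasis_type (E := E)
    rw [← mk_eq_hilbertDim b] at h ⊢
    have key := lift_hilbertDim_le_of_total (fun i => A (b i)) (fun y hy => hA y fun x => by
      have h0 : A.adjoint y = 0 := hilbertBasis_eq_zero b fun i => by
        rw [ContinuousLinearMap.adjoint_inner_right]
        exact hy i
      rw [← ContinuousLinearMap.adjoint_inner_right, h0, inner_zero_right])
    rwa [Cardinal.mul_aleph0_eq (Cardinal.aleph0_le_lift.2 h)] at key

/-- The adjoint of an injective operator has dense range. -/
theorem lift_hilbertDim_le_of_injective [CompleteSpace E] [CompleteSpace F] (A : E →L[ℂ] F)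
    (hA : Function.Injective A) :
    lift.{v} (hilbertDim E) ≤ lift.{u} (hilbertDim F) := by
  refine lift_hilbertDim_le_of_dense A.adjoint fun y hy => hA ?_
  rw [map_zero, ← inner_self_eq_zero (𝕜 := ℂ), ← ContinuousLinearMap.adjoint_inner_left]
  exact hy _

theorem lift_hilbertDim_eq_of_injective_of_dense [CompleteSpace E] [CompleteSpace F]
    (A : E →L[ℂ] F) (hA : Function.Injective A)
    (hd : ∀ y, (∀ x, inner ℂ (A x) y = 0) → y = 0) :
    lift.{v} (hilbertDim E) = lift.{u} (hilbertDim F) :=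
  le_antisymm (lift_hilbertDim_le_of_injective A hA) (lift_hilbertDim_le_of_dense A hd)

theorem lift_hilbertDim_eq_of_bijective [CompleteSpace E] [CompleteSpace F]
    (A : E →L[ℂ] F) (hA : Function.Bijective A) :
    lift.{v} (hilbertDim E) = lift.{u} (hilbertDim F) := by
  refine lift_hilbertDim_eq_of_injective_of_dense A hA.1 fun y hy => ?_
  obtain ⟨x, rfl⟩ := hA.2 y
  exact inner_self_eq_zero.1 (hy x)

theorem nonempty_linearIsometryEquiv_of_hilbertDim_eq {E F : Type u}
    [NormedAddCommGroup E] [InnerProductSpace ℂ E]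
    [NormedAddCommGroup F] [InnerProductSpace ℂ F] [CompleteSpace E] [CompleteSpace F]
    (h : hilbertDim E = hilbertDim F) : Nonempty (E ≃ₗᵢ[ℂ] F) := by
  obtain ⟨ι, ⟨b⟩⟩ := exists_hilbertBasis_type (E := E)
  obtain ⟨κ, ⟨b'⟩⟩ := exists_hilbertBasis_type (E := F)
  rw [← mk_eq_hilbertDim b, ← mk_eq_hilbertDim b', Cardinal.eq] at h
  obtain ⟨e⟩ := h
  let c : HilbertBasis ι ℂ F := HilbertBasis.mk (b'.orthonormal.comp e e.injective) (by
    rw [EquivLike.range_comp]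
    exact b'.dense_span.ge)
  exact ⟨b.repr.trans c.repr.symm⟩

theorem isClosed_inf_orthogonal {U : Submodule ℂ E} (V : Submodule ℂ E)
    (hU : IsClosed (U : Set E)) : IsClosed ((Vᗮ ⊓ U : Submodule ℂ E) : Set E) := by
  rw [Submodule.coe_inf]
  exact V.isClosed_orthogonal.inter hU

theorem mem_orthogonal_hilbertBasis {ι : Type*} {V : Submodule ℂ E} (b : HilbertBasis ι ℂ V)
    [CompleteSpace E] (hV : IsClosed (V : Set E)) {x : E}
    (hx : ∀ i, inner ℂ (b i : E) x = 0) : x ∈ Vᗮ := by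
  have := hV.completeSpace_coe
  rw [← Submodule.orthogonalProjectionOnto_eq_zero_iff]
  refine hilbertBasis_eq_zero b fun i => ?_
  rw [Submodule.coe_inner, ← Submodule.starProjection_apply,
    ← Submodule.inner_starProjection_left_eq_right,
    Submodule.starProjection_mem_subspace_eq_self]
  exact hx i

theorem hilbertDim_add_inf_orthogonal [CompleteSpace E] {U V : Submodule ℂ E}
    (hU : IsClosed (U : Set E)) (hV : IsClosed (V : Set E)) (hVU : V ≤ U) :
    hilbertDim V + hilbertDim ↥(Vᗮ ⊓ U) = hilbertDim U := by
  have := hU.completeSpace_coe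
  have := hV.completeSpace_coe
  have hW := isClosed_inf_orthogonal V hU
  have := hW.completeSpace_coe
  obtain ⟨ι, ⟨b⟩⟩ := exists_hilbertBasis_type (E := V)
  obtain ⟨κ, ⟨c⟩⟩ := exists_hilbertBasis_type (E := ↥(Vᗮ ⊓ U))
  rw [← mk_eq_hilbertDim b, ← mk_eq_hilbertDim c, Cardinal.add_def]
  let e : ι ⊕ κ → U := Sum.elim (fun i => ⟨b i, hVU (b i).2⟩) (fun k => ⟨c k, (c k).2.2⟩)
  have hort : ∀ i k, inner ℂ (b i : E) (c k : E) = 0 := fun i k =>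
    (Submodule.mem_orthogonal _ _).1 (c k).2.1 _ (b i).2
  refine mk_eq_hilbertDim_of_total (b := e) ?_ ?_
  · classical
    rw [orthonormal_iff_ite]
    rintro (i | i) (k | k)
    · simpa [e] using orthonormal_iff_ite.1 b.orthonormal i k
    · simpa [e] using hort i k
    · simpa [e] using inner_eq_zero_symm.1 (hort k i)
    · simpa [e] using orthonormal_iff_ite.1 c.orthonormal i k
  · intro x hx
    have h1 : (x : E) ∈ Vᗮ := mem_orthogonal_hilbertBasis b hV fun i => hx (Sum.inl i)
    have h2 : (x : E) ∈ (Vᗮ ⊓ U)ᗮ := mem_orthogonal_hilbertBasis c hW fun i => hx (Sum.inr i)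
    have := (Submodule.mem_orthogonal _ _).1 h2 x ⟨h1, x.2⟩
    exact Subtype.ext (inner_self_eq_zero.1 this)

theorem hilbertDim_top [CompleteSpace E] : hilbertDim (⊤ : Submodule ℂ E) = hilbertDim E := by
  have : CompleteSpace (⊤ : Submodule ℂ E) := isClosed_univ.completeSpace_coe
  simpa using lift_hilbertDim_eq_of_bijective (⊤ : Submodule ℂ E).subtypeL
    ⟨Subtype.val_injective, fun x => ⟨⟨x, trivial⟩, rfl⟩⟩

theorem hilbertDim_add_orthogonal [CompleteSpace E] {V : Submodule ℂ E}
    (hV : IsClosed (V : Set E)) : hilbertDim V + hilbertDim Vᗮ = hilbertDim E := by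
  have h := hilbertDim_add_inf_orthogonal (U := ⊤) isClosed_univ hV le_top
  rwa [inf_top_eq, hilbertDim_top] at h

/-- A closed subspace of prescribed dimension and codimension. -/
theorem exists_le_hilbertDim_eq [CompleteSpace E] {W : Submodule ℂ E}
    (hW : IsClosed (W : Set E)) {s t : Cardinal.{u}} (h : hilbertDim W = s + t) :
    ∃ V ≤ W, IsClosed (V : Set E) ∧ hilbertDim V = s ∧ hilbertDim ↥(Vᗮ ⊓ W) = t := by
  have := hW.completeSpace_coe
  obtain ⟨ι, ⟨b⟩⟩ := exists_hilbertBasis_type (E := W)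
  obtain ⟨S, rfl⟩ : ∃ S : Type u, #S = s := ⟨s.out, Cardinal.mk_out s⟩
  obtain ⟨T, rfl⟩ : ∃ T : Type u, #T = t := ⟨t.out, Cardinal.mk_out t⟩
  rw [← mk_eq_hilbertDim b, Cardinal.add_def, Cardinal.eq] at h
  obtain ⟨e⟩ := h
  let c : S ⊕ T → W := b ∘ e.symm
  have hc : Orthonormal ℂ c := b.orthonormal.comp _ e.symm.injective
  have hct : ∀ x : W, (∀ i, inner ℂ (c i) x = 0) → x = 0 := fun x hx =>
    hilbertBasis_eq_zero b fun i => by simpa [c] using hx (e i)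
  -- The orthogonal complement in `W` of the `T`-part of the basis, rather than the closed span of
  -- the `S`-part: closedness is then immediate.
  let V : Submodule ℂ E := (Submodule.span ℂ (Set.range fun i => (c (Sum.inr i) : E)))ᗮ ⊓ W
  have hV : IsClosed (V : Set E) := isClosed_inf_orthogonal _ hW
  have hVW := isClosed_inf_orthogonal V hW
  have := hV.completeSpace_coe
  have := hVW.completeSpace_coe
  have hmemV : ∀ x : W, (∀ i, inner ℂ (c (Sum.inr i)) x = 0) → (x : E) ∈ V := by
    intro x hx
    refine ⟨?_, x.2⟩
    rw [SetLike.mem_coe, Submodule.mem_orthogonal]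
    intro y hy
    induction hy using Submodule.span_induction with
    | mem y hy => obtain ⟨i, rfl⟩ := hy; exact hx i
    | zero => simp
    | add y z _ _ h1 h2 => rw [inner_add_left, h1, h2, add_zero]
    | smul a y _ h1 => rw [inner_smul_left, h1, mul_zero]
  have hcV : ∀ i, (c (Sum.inl i) : E) ∈ V := fun i => hmemV _ fun k => hc.2 (by simp)
  have hinr : ∀ i, ∀ x ∈ V, inner ℂ (c (Sum.inr i) : E) x = 0 := fun i x hx =>
    (Submodule.mem_orthogonal _ _).1 hx.1 _ (Submodule.subset_span ⟨i, rfl⟩)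
  have hcW : ∀ i, (c (Sum.inr i) : E) ∈ Vᗮ ⊓ W := fun i =>
    ⟨(Submodule.mem_orthogonal' _ _).2 (hinr i), (c _).2⟩
  refine ⟨V, inf_le_right, hV, ?_, ?_⟩
  · symm
    refine mk_eq_hilbertDim_of_total (b := fun i => (⟨c (Sum.inl i), hcV i⟩ : V)) ?_ ?_
    · exact ⟨fun i => hc.1 (Sum.inl i), fun i k hik => hc.2 (by simpa using hik)⟩
    · intro x hx
      have := hct ⟨x, x.2.2⟩ (by rintro (i | i); exacts [hx i, hinr i x x.2])
      exact Subtype.ext (by simpa using this)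
  · symm
    refine mk_eq_hilbertDim_of_total (b := fun i => (⟨c (Sum.inr i), hcW i⟩ : ↥(Vᗮ ⊓ W))) ?_ ?_
    · exact ⟨fun i => hc.1 (Sum.inr i), fun i k hik => hc.2 (by simpa using hik)⟩
    · intro x hx
      have := (Submodule.mem_orthogonal _ _).1 x.2.1 _ (hmemV ⟨x, x.2.2⟩ hx)
      exact Subtype.ext (inner_self_eq_zero.1 this)

/-- Closed complements of a closed subspace all have the same dimension. -/
theorem hilbertDim_orthogonal_eq_of_isCompl [CompleteSpace E] {X Z : Submodule ℂ E}
    (hX : IsClosed (X : Set E)) (hZ : IsClosed (Z : Set E)) (h : IsCompl X Z) :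
    hilbertDim Xᗮ = hilbertDim Z := by
  have := hX.completeSpace_coe
  have := hZ.completeSpace_coe
  symm
  -- The orthogonal projection along `X` restricts to a bijection from `Z` onto `Xᗮ`.
  have := lift_hilbertDim_eq_of_bijective (Xᗮ.orthogonalProjectionOnto ∘L Z.subtypeL) ⟨?_, ?_⟩
  · simpa using this
  · rw [injective_iff_map_eq_zero]
    intro z hz
    have h1 : (z : E) ∈ X := by
      have : Xᗮ.orthogonalProjectionOnto (z : E) = 0 := hz
      rwa [Submodule.orthogonalProjectionOnto_eq_zero_iff, Submodule.orthogonal_orthogonal] at this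
    exact Subtype.ext (Submodule.disjoint_def.1 h.disjoint _ h1 z.2)
  · intro y
    obtain ⟨x, hx, z, hz, hxz⟩ := Submodule.mem_sup.1
      (show (y : E) ∈ X ⊔ Z by rw [h.sup_eq_top]; trivial)
    refine ⟨⟨z, hz⟩, ?_⟩
    have h1 : Xᗮ.orthogonalProjectionOnto x = 0 := by
      rwa [Submodule.orthogonalProjectionOnto_eq_zero_iff, Submodule.orthogonal_orthogonal]
    have h2 : Xᗮ.orthogonalProjectionOnto (y : E) = y :=
      Submodule.orthogonalProjectionOnto_mem_subspace_eq_self y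
    rw [← hxz, map_add, h1, zero_add] at h2
    exact h2

end Dimension

/-! ### Operators bounded below on a closed subspace -/

section Operators

variable {H : Type u} {K : Type v} [NormedAddCommGroup H] [InnerProductSpace ℂ H]
  [NormedAddCommGroup K] [InnerProductSpace ℂ K]

/-- `A` is bounded below on `X` with constant `c`. -/
def IsBoundedBelowOn (A : H →L[ℂ] K) (X : Submodule ℂ H) (c : ℝ) : Prop :=
  ∀ x ∈ X, c * ‖x‖ ≤ ‖A x‖

theorem mem_ran (A : H →L[ℂ] K) (x : H) : A x ∈ ran A := ⟨x, rfl⟩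

theorem isClosed_nul (A : H →L[ℂ] K) : IsClosed (nul A : Set H) := A.isClosed_ker

theorem IsBoundedBelowOn.eq_zero {A : H →L[ℂ] K} {X : Submodule ℂ H} {c : ℝ} (hc : 0 < c)
    (h : IsBoundedBelowOn A X c) {x : H} (hx : x ∈ X) (h0 : A x = 0) : x = 0 := by
  have := h x hx
  rw [h0, norm_zero] at this
  exact norm_le_zero_iff.1 (by nlinarith [norm_nonneg x])

theorem map_le_ran (A : H →L[ℂ] K) (X : Submodule ℂ H) : X.map (A : H →ₗ[ℂ] K) ≤ ran A :=
  LinearMap.map_le_range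

theorem IsBoundedBelowOn.of_norm_sub_le {A B : H →L[ℂ] K} {X : Submodule ℂ H} {c d : ℝ}
    (h : IsBoundedBelowOn A X c) (hd : ‖B - A‖ ≤ d) : IsBoundedBelowOn B X (c - d) := by
  intro x hx
  have h1 := h x hx
  have h2 : ‖(B - A) x‖ ≤ d * ‖x‖ := (B - A).le_of_opNorm_le hd x
  have h3 : ‖A x‖ ≤ ‖B x‖ + ‖(B - A) x‖ := by
    have : A x = B x - (B - A) x := by simp
    rw [this]
    exact norm_sub_le _ _
  linarith

theorem hilbertDim_orthogonal_of_le_ran [CompleteSpace K] {A : H →L[ℂ] K}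
    {V : Submodule ℂ K} (hVA : V ≤ ran A) :
    hilbertDim Vᗮ = hilbertDim ↥((ran A).topologicalClosureᗮ) +
      hilbertDim ↥(Vᗮ ⊓ (ran A).topologicalClosure) := by
  have := (ran A).isClosed_topologicalClosure.completeSpace_coe
  have h := hilbertDim_add_inf_orthogonal V.isClosed_orthogonal
    (Submodule.isClosed_orthogonal (ran A).topologicalClosure)
    (Submodule.orthogonal_le (hVA.trans (ran A).le_topologicalClosure))
  rw [Submodule.orthogonal_orthogonal, inf_comm] at h
  exact h.symm

/-- The corestriction of `A` to a map from `X` onto `A X`. -/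
def mapRestrict (A : H →L[ℂ] K) (X : Submodule ℂ H) : X →L[ℂ] X.map (A : H →ₗ[ℂ] K) :=
  (A ∘L X.subtypeL).codRestrict _ fun x => ⟨x, x.2, rfl⟩

theorem IsBoundedBelowOn.bijective_mapRestrict {A : H →L[ℂ] K} {X : Submodule ℂ H} {c : ℝ}
    (hc : 0 < c) (h : IsBoundedBelowOn A X c) : Function.Bijective (mapRestrict A X) := by
  constructor
  · rw [injective_iff_map_eq_zero]
    intro x hx
    exact Subtype.ext (h.eq_zero hc x.2 (congrArg Subtype.val hx))
  · rintro ⟨_, x, hx, rfl⟩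
    exact ⟨⟨x, hx⟩, rfl⟩

variable [CompleteSpace H]

theorem IsBoundedBelowOn.isClosed_map {A : H →L[ℂ] K} {X : Submodule ℂ H} {c : ℝ} (hc : 0 < c)
    (h : IsBoundedBelowOn A X c) (hX : IsClosed (X : Set H)) :
    IsClosed (X.map (A : H →ₗ[ℂ] K) : Set K) := by
  have := hX.completeSpace_coe
  have ha : AntilipschitzWith (Real.toNNReal c⁻¹) (A ∘L X.subtypeL) := by
    refine ContinuousLinearMap.antilipschitz_of_bound _ fun x => ?_
    rw [Real.coe_toNNReal _ (inv_nonneg.2 hc.le), le_inv_mul_iff₀ hc]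
    exact h x x.2
  have hr := ha.isClosed_range (A ∘L X.subtypeL).uniformContinuous
  convert hr using 1
  ext y
  simp

variable [CompleteSpace K]

/-- Every closed subspace of the range is the image of a closed subspace on which `A` is bounded
below. -/
theorem exists_isBoundedBelowOn {A : H →L[ℂ] K} {V : Submodule ℂ K} (hV : IsClosed (V : Set K))
    (hVA : V ≤ ran A) : ∃ (X : Submodule ℂ H) (c : ℝ), IsClosed (X : Set H) ∧ 0 < c ∧
      IsBoundedBelowOn A X c ∧ X.map (A : H →ₗ[ℂ] K) = V := by
  -- Removing the kernel makes `A` bijective from `X` onto `V`; the open mapping theorem then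
  -- supplies the lower bound.
  let X : Submodule ℂ H := (nul A)ᗮ ⊓ V.comap (A : H →ₗ[ℂ] K)
  have hX : IsClosed (X : Set H) := isClosed_inf_orthogonal _ (hV.preimage A.continuous)
  have := hX.completeSpace_coe
  have := hV.completeSpace_coe
  have := (isClosed_nul A).completeSpace_coe
  have hmap : X.map (A : H →ₗ[ℂ] K) = V := by
    apply le_antisymm
    · rintro _ ⟨x, hx, rfl⟩
      exact hx.2
    · intro y hy
      obtain ⟨h, rfl⟩ := hVA hy
      obtain ⟨n, hn, m, hm, rfl⟩ := (nul A).exists_add_mem_mem_orthogonal h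
      have hn0 : A n = 0 := hn
      have hA : A (n + m) = A m := by rw [map_add, hn0, zero_add]
      refine ⟨m, ⟨hm, ?_⟩, hA.symm⟩
      have hy' : A (n + m) ∈ V := hy
      rwa [hA] at hy'
  let B : X →L[ℂ] V := (A ∘L X.subtypeL).codRestrict V fun x => x.2.2
  have hBi : LinearMap.ker (B : X →ₗ[ℂ] V) = ⊥ := by
    rw [LinearMap.ker_eq_bot']
    intro x hx
    have hx0 : A x = 0 := congrArg Subtype.val hx
    have := (Submodule.mem_orthogonal _ _).1 x.2.1 x hx0
    exact Subtype.ext (inner_self_eq_zero.1 this)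
  have hBs : LinearMap.range (B : X →ₗ[ℂ] V) = ⊤ := by
    rw [LinearMap.range_eq_top]
    rintro ⟨y, hy⟩
    rw [← hmap] at hy
    obtain ⟨x, hx, rfl⟩ := hy
    exact ⟨⟨x, hx⟩, rfl⟩
  let e := ContinuousLinearEquiv.ofBijective B hBi hBs
  refine ⟨X, (‖(e.symm : V →L[ℂ] X)‖ + 1)⁻¹, hX, by positivity, fun x hx => ?_, hmap⟩
  rw [inv_mul_le_iff₀ (by positivity)]
  have h1 : ‖e.symm (e ⟨x, hx⟩)‖ ≤ ‖(e.symm : V →L[ℂ] X)‖ * ‖e ⟨x, hx⟩‖ :=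
    (e.symm : V →L[ℂ] X).le_opNorm _
  rw [e.symm_apply_apply] at h1
  have h2 : ‖e ⟨x, hx⟩‖ = ‖A x‖ := rfl
  have h3 : ‖(⟨x, hx⟩ : X)‖ = ‖x‖ := rfl
  rw [h2, h3] at h1
  nlinarith [norm_nonneg (A x)]

theorem lift_hilbertDim_map {A : H →L[ℂ] K} {X : Submodule ℂ H} {c : ℝ} (hc : 0 < c)
    (h : IsBoundedBelowOn A X c) (hX : IsClosed (X : Set H)) :
    lift.{u} (hilbertDim (X.map (A : H →ₗ[ℂ] K))) = lift.{v} (hilbertDim X) := by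
  have := hX.completeSpace_coe
  have := (h.isClosed_map hc hX).completeSpace_coe
  exact (lift_hilbertDim_eq_of_bijective _ (h.bijective_mapRestrict hc)).symm

/-- The component of `A y` in `A X` lifts to some `x ∈ X`, and then `A (y - x)` is orthogonal to `A
X`. This trades `Xᗮ` for a complement of the same dimension that contains the kernel. -/
theorem isCompl_comap_orthogonal {A : H →L[ℂ] K} {X : Submodule ℂ H} {c : ℝ} (hc : 0 < c)
    (h : IsBoundedBelowOn A X c) (hX : IsClosed (X : Set H)) :
    IsCompl X ((X.map (A : H →ₗ[ℂ] K))ᗮ.comap (A : H →ₗ[ℂ] K)) := by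
  have := (h.isClosed_map hc hX).completeSpace_coe
  constructor
  · rw [Submodule.disjoint_def]
    intro x hx hx'
    refine h.eq_zero hc hx ?_
    have := (Submodule.mem_orthogonal _ _).1 hx' (A x) ⟨x, hx, rfl⟩
    exact inner_self_eq_zero.1 this
  · rw [codisjoint_iff, eq_top_iff]
    intro y _
    obtain ⟨v, ⟨x, hx, hxv⟩, w, hw, hvw⟩ :=
      (X.map (A : H →ₗ[ℂ] K)).exists_add_mem_mem_orthogonal (A y)
    refine Submodule.mem_sup.2 ⟨x, hx, y - x, ?_, by abel⟩
    have hxv' : A x = v := hxv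
    have : A (y - x) = w := by rw [map_sub, hvw, hxv']; abel
    rw [Submodule.mem_comap]
    exact this ▸ hw

/-- The dimension of `A ⁻¹(Vᗮ)` for a closed subspace `V` of the range of `A`. -/
theorem hilbertDim_comap_orthogonal {A : H →L[ℂ] K} {V : Submodule ℂ K}
    (hV : IsClosed (V : Set K)) (hVA : V ≤ ran A) :
    lift.{v} (hilbertDim (Vᗮ.comap (A : H →ₗ[ℂ] K))) =
      lift.{v} (hilbertDim (nul A)) +
        lift.{u} (hilbertDim ↥(Vᗮ ⊓ (ran A).topologicalClosure)) := by
  set Z := Vᗮ.comap (A : H →ₗ[ℂ] K) with hZdef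
  have hZ : IsClosed (Z : Set H) := V.isClosed_orthogonal.preimage A.continuous
  have hNZ : nul A ≤ Z := fun x hx => by
    have : A x = 0 := hx
    rw [hZdef, Submodule.mem_comap]
    change A x ∈ Vᗮ
    rw [this]
    exact zero_mem _
  rw [← hilbertDim_add_inf_orthogonal hZ (isClosed_nul A) hNZ, lift_add]
  congr 1
  have := (isClosed_inf_orthogonal (nul A) hZ).completeSpace_coe
  have := (isClosed_inf_orthogonal V (ran A).isClosed_topologicalClosure).completeSpace_coe
  have := (isClosed_nul A).completeSpace_coe
  have := hV.completeSpace_coe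
  let B : ↥((nul A)ᗮ ⊓ Z) →L[ℂ] ↥(Vᗮ ⊓ (ran A).topologicalClosure) :=
    (A ∘L ((nul A)ᗮ ⊓ Z).subtypeL).codRestrict _ fun x =>
      ⟨x.2.2, (ran A).le_topologicalClosure (mem_ran A x)⟩
  refine lift_hilbertDim_eq_of_injective_of_dense B ?_ ?_
  · rw [injective_iff_map_eq_zero]
    intro x hx
    have hx0 : A x = 0 := congrArg Subtype.val hx
    have := (Submodule.mem_orthogonal _ _).1 x.2.1 x hx0
    exact Subtype.ext (inner_self_eq_zero.1 this)
  · rintro ⟨y, hyV, hyR⟩ hy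
    have h1 : ∀ z ∈ Z, inner ℂ (A z) y = 0 := by
      intro z hz
      obtain ⟨n, hn, m, hm, rfl⟩ := (nul A).exists_add_mem_mem_orthogonal z
      have hn0 : A n = 0 := hn
      have hm' : m ∈ Z := by simpa using Z.sub_mem hz (hNZ hn)
      rw [map_add, hn0, zero_add]
      exact hy ⟨m, hm, hm'⟩
    -- `A h` is a vector of `V` plus a vector of `A Z`, and `y` is orthogonal to both.
    have h2 : ∀ h, inner ℂ (A h) y = 0 := by
      intro h
      obtain ⟨v, hv, w, hw, hvw⟩ := V.exists_add_mem_mem_orthogonal (A h)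
      obtain ⟨x, rfl⟩ := hVA hv
      have hw' : A (h - x) = w := by
        rw [map_sub, hvw]
        exact add_sub_cancel_left _ _
      have h3 := h1 (h - x) (by rw [hZdef, Submodule.mem_comap]; exact hw' ▸ hw)
      rw [hvw, inner_add_left, (Submodule.mem_orthogonal _ _).1 hyV _ hv, zero_add, ← hw', h3]
    have h4 : y ∈ ((ran A).topologicalClosure)ᗮ := by
      rw [Submodule.orthogonal_closure, Submodule.mem_orthogonal]
      rintro _ ⟨h, rfl⟩
      exact h2 h
    exact Subtype.ext (inner_self_eq_zero.1 ((Submodule.mem_orthogonal _ _).1 h4 y hyR))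

/-- The left side does not involve `A`, so the sum on the right is the same for any two operators
bounded below on `X`. -/
theorem lift_hilbertDim_orthogonal {A : H →L[ℂ] K} {X : Submodule ℂ H} {c : ℝ} (hc : 0 < c)
    (h : IsBoundedBelowOn A X c) (hX : IsClosed (X : Set H)) :
    lift.{v} (hilbertDim Xᗮ) = lift.{v} (hilbertDim (nul A)) +
      lift.{u} (hilbertDim ↥((X.map (A : H →ₗ[ℂ] K))ᗮ ⊓ (ran A).topologicalClosure)) := by
  rw [← hilbertDim_comap_orthogonal (h.isClosed_map hc hX) (map_le_ran A X)]
  congr 1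
  exact hilbertDim_orthogonal_eq_of_isCompl hX
    ((Submodule.isClosed_orthogonal _).preimage A.continuous) (isCompl_comap_orthogonal hc h hX)

/-- The projection of `(A X)ᗮ` to `(B X)ᗮ` is injective: a vector `B x` in its kernel is orthogonal
to `A x`, whence `c ‖x‖ ≤ ‖A x‖ ≤ ‖(B - A) x‖`, which forces `x = 0` because `‖B - A‖ < c`. -/
theorem hilbertDim_orthogonal_map_le {A B : H →L[ℂ] K} {X : Submodule ℂ H} {c : ℝ}
    (hA : IsBoundedBelowOn A X c) (hB : IsBoundedBelowOn B X c) (hX : IsClosed (X : Set H))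
    (hAB : ‖B - A‖ < c) :
    hilbertDim ↥((X.map (A : H →ₗ[ℂ] K))ᗮ) ≤ hilbertDim ↥((X.map (B : H →ₗ[ℂ] K))ᗮ) := by
  have hc : 0 < c := (norm_nonneg _).trans_lt hAB
  have := (hB.isClosed_map hc hX).completeSpace_coe
  set V := X.map (A : H →ₗ[ℂ] K)
  set W := X.map (B : H →ₗ[ℂ] K)
  have key := lift_hilbertDim_le_of_injective (Wᗮ.orthogonalProjectionOnto ∘L Vᗮ.subtypeL) (by
    rw [injective_iff_map_eq_zero]
    intro y hy
    have h1 : (y : K) ∈ W := by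
      have : Wᗮ.orthogonalProjectionOnto (y : K) = 0 := hy
      rwa [Submodule.orthogonalProjectionOnto_eq_zero_iff, Submodule.orthogonal_orthogonal] at this
    obtain ⟨x, hx, hxy⟩ := h1
    have hxy' : B x = y := hxy
    have h2 : inner ℂ (A x) (B x) = 0 := by
      rw [hxy']
      exact (Submodule.mem_orthogonal _ _).1 y.2 _ ⟨x, hx, rfl⟩
    have h3 : ‖A x‖ ^ 2 ≤ ‖A x‖ * ‖(B - A) x‖ := by
      have h4 : (inner ℂ (A x) (A x) : ℂ) = - inner ℂ (A x) ((B - A) x) := by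
        rw [sub_apply, inner_sub_right, h2]; ring
      have h5 : ‖(inner ℂ (A x) (A x) : ℂ)‖ = ‖A x‖ ^ 2 := by
        rw [inner_self_eq_norm_sq_to_K]; simp
      rw [← h5, h4, norm_neg]
      exact norm_inner_le_norm _ _
    have h6 : ‖(B - A) x‖ ≤ ‖B - A‖ * ‖x‖ := (B - A).le_opNorm x
    have h7 := hA x hx
    have hx0 : x = 0 := by
      by_contra hne
      have hpos : 0 < ‖x‖ := norm_pos_iff.2 hne
      have : ‖A x‖ ≤ ‖(B - A) x‖ := by
        have : 0 < ‖A x‖ := lt_of_lt_of_le (mul_pos hc hpos) h7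
        nlinarith
      nlinarith
    exact Subtype.ext (by rw [← hxy', hx0, map_zero]; rfl))
  simpa using key

/-- Images of a subspace under nearby operators have complements of the same dimension. -/
theorem hilbertDim_orthogonal_map_eq {A B : H →L[ℂ] K} {X : Submodule ℂ H} {c : ℝ}
    (hA : IsBoundedBelowOn A X c) (hB : IsBoundedBelowOn B X c) (hX : IsClosed (X : Set H))
    (hAB : ‖B - A‖ < c) :
    hilbertDim ↥((X.map (A : H →ₗ[ℂ] K))ᗮ) = hilbertDim ↥((X.map (B : H →ₗ[ℂ] K))ᗮ) :=
  le_antisymm (hilbertDim_orthogonal_map_le hA hB hX hAB)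
    (hilbertDim_orthogonal_map_le hB hA hX (by rwa [norm_sub_rev]))

/-- A substitute for the spectral subspace of `|A|` for `[√ε, ∞)`. -/
theorem exists_isBoundedBelowOn_norm_le (A : H →L[ℂ] K) {ε : ℝ} (hε : 0 < ε) :
    ∃ X : Submodule ℂ H, IsClosed (X : Set H) ∧ IsBoundedBelowOn A X ε ∧
      ∀ x ∈ Xᗮ, ‖A x‖ ≤ ε * ‖x‖ := by
  set T : H →L[ℂ] H := A.adjoint ∘L A
  have hT : IsSelfAdjoint T := by
    rw [ContinuousLinearMap.isSelfAdjoint_iff']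
    simp [T, ContinuousLinearMap.adjoint_comp]
  have hTx : ∀ x, (inner ℂ (T x) x : ℂ) = ((‖A x‖ ^ 2 : ℝ) : ℂ) := fun x => by
    simp only [T, ContinuousLinearMap.comp_apply, ContinuousLinearMap.adjoint_inner_left]
    rw [inner_self_eq_norm_sq_to_K]
    simp
  -- The cut is at ε² for `A* A`, that is, at ε for `|A|`. With `S = f(T)`, positivity of `S (T -
  -- ε²) S` gives the lower bound on the range of `S`, and `T ≤ ε² + S` gives the upper bound on the
  -- kernel of `S`.
  let f : ℝ → ℝ := fun t => max (t - ε ^ 2) 0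
  have hf : Continuous f := by fun_prop
  set S : H →L[ℂ] H := cfc f T
  have hS : IsSelfAdjoint S := cfc_predicate f T
  have hSx : ∀ x y, (inner ℂ (S x) y : ℂ) = inner ℂ x (S y) := fun x y => by
    rw [← ContinuousLinearMap.adjoint_inner_right, hS.adjoint_eq]
  have hsc : ∀ x, (inner ℂ (algebraMap ℝ (H →L[ℂ] H) (ε ^ 2) x) x : ℂ) =
      ((ε ^ 2 * ‖x‖ ^ 2 : ℝ) : ℂ) := fun x => by
    have h1 : algebraMap ℝ (H →L[ℂ] H) (ε ^ 2) x = ((ε ^ 2 : ℝ) : ℂ) • x := by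
      rw [Algebra.algebraMap_eq_smul_one]
      exact (Complex.coe_smul _ x).symm
    rw [h1, inner_smul_left, inner_self_eq_norm_sq_to_K]
    simp
  have hR : 0 ≤ S * (T - algebraMap ℝ _ (ε ^ 2)) * S := by
    have h1 : cfc (fun t => f t * (t - ε ^ 2) * f t) T =
        S * (T - algebraMap ℝ _ (ε ^ 2)) * S := by
      rw [cfc_mul _ _ T (by fun_prop) (by fun_prop), cfc_mul _ _ T (by fun_prop) (by fun_prop),
        cfc_sub _ _ T (by fun_prop) (by fun_prop), cfc_id' ℝ T, cfc_const (ε ^ 2) T]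
    rw [← h1]
    refine cfc_nonneg fun t _ => ?_
    have : 0 ≤ f t ∧ (f t = 0 ∨ 0 ≤ t - ε ^ 2) := by
      refine ⟨le_max_right _ _, ?_⟩
      rcases le_total (t - ε ^ 2) 0 with h | h
      · exact Or.inl (max_eq_right h)
      · exact Or.inr h
    rcases this with ⟨h0, h1 | h1⟩
    · simp [h1]
    · positivity
  have hL : T ≤ algebraMap ℝ _ (ε ^ 2) + S := by
    have h1 : cfc (fun t => ε ^ 2 + f t) T = algebraMap ℝ _ (ε ^ 2) + S := by
      rw [cfc_add T _ _ (by fun_prop) (by fun_prop), cfc_const (ε ^ 2) T]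
    rw [← h1]
    conv_lhs => rw [← cfc_id' ℝ T]
    refine cfc_mono (fun t _ => ?_) (by fun_prop) (by fun_prop)
    have : t - ε ^ 2 ≤ f t := le_max_left _ _
    linarith
  have hsq : ∀ {a b : ℝ}, 0 ≤ a → 0 ≤ b → a ^ 2 ≤ b ^ 2 → a ≤ b := fun _ hb h =>
    le_of_sq_le_sq h hb
  refine ⟨(ran S).topologicalClosure, Submodule.isClosed_topologicalClosure _, ?_, ?_⟩
  · have hcl : IsClosed {x : H | ε * ‖x‖ ≤ ‖A x‖} :=
      isClosed_le (by fun_prop) (by fun_prop)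
    refine fun x hx => closure_minimal (s := (ran S : Set H)) ?_ hcl hx
    rintro _ ⟨y, rfl⟩
    have h1 := ((ContinuousLinearMap.nonneg_iff_isPositive _).1 hR).re_inner_nonneg_left y
    have h2 : (inner ℂ ((S * (T - algebraMap ℝ _ (ε ^ 2)) * S) y) y : ℂ) =
        ((‖A (S y)‖ ^ 2 - ε ^ 2 * ‖S y‖ ^ 2 : ℝ) : ℂ) := by
      rw [mul_apply_eq_comp, mul_apply_eq_comp, hSx, sub_apply,
        inner_sub_left, hTx, hsc, Complex.ofReal_sub]
    rw [h2] at h1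
    have h3 : 0 ≤ ‖A (S y)‖ ^ 2 - ε ^ 2 * ‖S y‖ ^ 2 := h1
    exact hsq (by positivity) (norm_nonneg _) (by rw [mul_pow]; exact sub_nonneg.1 h3)
  · intro x hx
    have hSx0 : S x = 0 := by
      rw [Submodule.orthogonal_closure, Submodule.mem_orthogonal] at hx
      rw [← inner_self_eq_zero (𝕜 := ℂ), ← hSx]
      exact hx _ ⟨S x, rfl⟩
    have h1 := ((ContinuousLinearMap.le_def _ _).1 hL).re_inner_nonneg_left x
    have h2 : (inner ℂ ((algebraMap ℝ (H →L[ℂ] H) (ε ^ 2) + S - T) x) x : ℂ) =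
        ((ε ^ 2 * ‖x‖ ^ 2 - ‖A x‖ ^ 2 : ℝ) : ℂ) := by
      rw [sub_apply, add_apply, hSx0, add_zero, inner_sub_left, hTx, hsc, Complex.ofReal_sub]
    rw [h2] at h1
    have h3 : 0 ≤ ε ^ 2 * ‖x‖ ^ 2 - ‖A x‖ ^ 2 := h1
    exact hsq (norm_nonneg _) (by positivity) (by rw [mul_pow]; exact sub_nonneg.1 h3)

end Operators

/-! ### Cancellation for cardinals -/

section Arithmetic

/-- A finite `s` cancels. Otherwise `s < s + b` forces `b = s'`, and `s` is absorbed by `n + a`,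
since the right side of `h` would otherwise be `s < s'`. -/
theorem add_eq_add_of_add_left {n a s s' b : Cardinal.{u}} (hn : ℵ₀ ≤ n) (hb : s + b = s')
    (h : n + s' = n + a + s) (hs : s < ℵ₀ ∨ s < s') : n + b = n + a := by
  by_cases hfin : s < ℵ₀
  · rw [← hb, add_comm s b, ← add_assoc] at h
    exact Cardinal.eq_of_add_eq_add_right h hfin
  · have hs' : s < s' := hs.resolve_left hfin
    have hinf : ℵ₀ ≤ s := not_lt.1 hfin
    have hbs : s ≤ b := by
      by_contra! hlt
      rw [add_eq_left hinf hlt.le] at hb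
      exact hs'.ne hb
    have hb' : b = s' := by rw [← hb, add_eq_right (hinf.trans hbs) hbs]
    rw [hb', h]
    refine add_eq_left (hn.trans (self_le_add_right _ _)) ?_
    by_contra! hlt
    rw [add_eq_right hinf hlt.le] at h
    exact (hs'.trans_le (self_le_add_left s' n)).ne' h

/-- If `n + s' = n + a + s` and `m + s' = m + a + s` with `s ≤ s'`, then `s' = s + b` for some `b`
that can replace `a`. -/
theorem exists_add_eq_and_add_eq {n m a s s' : Cardinal.{u}} (hs : s ≤ s')
    (hn : n + s' = n + a + s) (hm : m + s' = m + a + s) :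
    ∃ b, s + b = s' ∧ n + b = n + a ∧ m + b = m + a := by
  by_cases hnf : n < ℵ₀
  · rw [add_assoc] at hn
    have := Cardinal.eq_of_add_eq_add_left hn hnf
    exact ⟨a, by rw [this, add_comm], rfl, rfl⟩
  by_cases hmf : m < ℵ₀
  · rw [add_assoc] at hm
    have := Cardinal.eq_of_add_eq_add_left hm hmf
    exact ⟨a, by rw [this, add_comm], rfl, rfl⟩
  rw [not_lt] at hnf hmf
  by_cases hcase : s < ℵ₀ ∨ s < s'
  · obtain ⟨b, hb⟩ := exists_add_of_le hs
    exact ⟨b, hb.symm, add_eq_add_of_add_left hnf hb.symm hn hcase,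
      add_eq_add_of_add_left hmf hb.symm hm hcase⟩
  -- Here `s = s'` is infinite, and `b = min a s` works.
  · simp only [not_or, not_lt] at hcase
    obtain rfl : s = s' := le_antisymm hs hcase.2
    rcases le_total a s with ha | ha
    · exact ⟨a, add_eq_left hcase.1 ha, rfl, rfl⟩
    · have ha' : a + s = a := add_eq_left (hcase.1.trans ha) ha
      rw [add_assoc, ha'] at hn hm
      exact ⟨s, add_eq_self hcase.1, hn, hm⟩

end Arithmetic

/-! ### Splits of the range and the indices -/

section Splits

variable {H : Type u} {K : Type v} [NormedAddCommGroup H] [InnerProductSpace ℂ H]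
  [NormedAddCommGroup K] [InnerProductSpace ℂ K]

/-- The dimension of the kernel. -/
noncomputable def nullity (A : H →L[ℂ] K) : Cardinal.{max u v} := lift.{v} (hilbertDim (nul A))

/-- The dimension of the orthogonal complement of the range. -/
noncomputable def corank (A : H →L[ℂ] K) : Cardinal.{max u v} :=
  lift.{u} (hilbertDim ↥((ran A).topologicalClosureᗮ))

/-- The index of incompleteness of the range. -/
noncomputable def icIndex (A : H →L[ℂ] K) : Cardinal.{max u v} :=
  lift.{u} (incompletenessIndex (ran A))

/-- The range of `A` contains a closed subspace of dimension `s` whose orthogonal complement in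
the closure of the range has dimension `t`. -/
def HasSplit (A : H →L[ℂ] K) (s t : Cardinal.{max u v}) : Prop :=
  ∃ V ≤ ran A, IsClosed (V : Set K) ∧ lift.{u} (hilbertDim V) = s ∧
    lift.{u} (hilbertDim ↥(Vᗮ ⊓ (ran A).topologicalClosure)) = t

theorem exists_hasSplit_icIndex [CompleteSpace K] (A : H →L[ℂ] K) :
    ∃ s, HasSplit A s (icIndex A) := by
  obtain ⟨V, hVA, hV, h⟩ := csInf_mem (s := {c | ∃ V : Submodule ℂ K, V ≤ ran A ∧
    IsComplete (V : Set K) ∧ hilbertDim ↥(Vᗮ ⊓ (ran A).topologicalClosure) = c})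
    ⟨_, ⊥, bot_le,
      (⊥ : Submodule ℂ K).closed_of_finiteDimensional.isComplete, rfl⟩
  exact ⟨_, V, hVA, hV.isClosed, rfl, congrArg lift.{u} h⟩

theorem opBinaryIndex_eq_zero_iff {A : H →L[ℂ] K} :
    opBinaryIndex A = 0 ↔ ¬ opBinaryIndex A = 1 := by
  unfold opBinaryIndex binaryIndex
  split_ifs <;> simp

variable [CompleteSpace K] {A : H →L[ℂ] K} {s t : Cardinal.{max u v}}

theorem HasSplit.add_eq (h : HasSplit A s t) : s + t = rangeIndex A := by
  obtain ⟨V, hVA, hV, rfl, rfl⟩ := h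
  rw [← lift_add, hilbertDim_add_inf_orthogonal (ran A).isClosed_topologicalClosure hV
    (hVA.trans (ran A).le_topologicalClosure), rangeIndex]

theorem HasSplit.icIndex_le (h : HasSplit A s t) : icIndex A ≤ t := by
  obtain ⟨V, hVA, hV, rfl, rfl⟩ := h
  exact lift_le.2 (csInf_le' ⟨V, hVA, hV.isComplete, rfl⟩)

/-- Shrinking `V` to `W` adds `Wᗮ ⊓ V` to the complement, which stays orthogonal to the old
complement. -/
theorem HasSplit.trim {s' : Cardinal.{max u v}} (h : HasSplit A (s + s') t) :
    HasSplit A s (s' + t) := by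
  obtain ⟨V, hVA, hV, hs, rfl⟩ := h
  obtain ⟨a, rfl⟩ := mem_range_lift_of_le (hs ▸ self_le_add_right s s')
  obtain ⟨b, rfl⟩ := mem_range_lift_of_le (hs ▸ self_le_add_left s' _)
  rw [← lift_add, lift_inj] at hs
  obtain ⟨W, hWV, hW, rfl, rfl⟩ := exists_le_hilbertDim_eq hV hs
  refine ⟨W, hWV.trans hVA, hW, rfl, ?_⟩
  have hR := (ran A).isClosed_topologicalClosure
  have := hV.completeSpace_coe
  have := hW.completeSpace_coe
  rw [← lift_add, ← hilbertDim_add_inf_orthogonal (isClosed_inf_orthogonal W hR)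
    (isClosed_inf_orthogonal W hV)
    (inf_le_inf_left _ (hVA.trans (ran A).le_topologicalClosure))]
  have key : (Wᗮ ⊓ V)ᗮ ⊓ (Wᗮ ⊓ (ran A).topologicalClosure) = Vᗮ ⊓ (ran A).topologicalClosure := by
    apply le_antisymm
    · rintro x ⟨hx, hxW, hxR⟩
      refine ⟨?_, hxR⟩
      rw [SetLike.mem_coe, Submodule.mem_orthogonal]
      intro v hv
      obtain ⟨w, hw, z, hz, rfl⟩ := W.exists_add_mem_mem_orthogonal v
      have hzV : z ∈ V := by simpa using V.sub_mem hv (hWV hw)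
      rw [inner_add_left, (Submodule.mem_orthogonal _ _).1 hxW w hw,
        (Submodule.mem_orthogonal _ _).1 hx z ⟨hz, hzV⟩, add_zero]
    · rintro x ⟨hx, hxR⟩
      exact ⟨Submodule.orthogonal_le inf_le_right hx, Submodule.orthogonal_le hWV hx, hxR⟩
  rw [key]

theorem corank_add_rangeIndex (A : H →L[ℂ] K) :
    corank A + rangeIndex A = lift.{u} (hilbertDim K) := by
  rw [corank, rangeIndex, ← lift_add, add_comm,
    hilbertDim_add_orthogonal (ran A).isClosed_topologicalClosure]

/-- A subspace isomorphic to a complete space is closed, and Hilbert spaces of equal dimension are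
isomorphic. -/
theorem opBinaryIndex_eq_one_iff : opBinaryIndex A = 1 ↔ ∃ t, HasSplit A (rangeIndex A) t := by
  have hR := (ran A).isClosed_topologicalClosure.completeSpace_coe
  have hb : opBinaryIndex A = 1 ↔
      ∃ V : Submodule ℂ K, V ≤ ran A ∧ Nonempty (V ≃L[ℂ] (ran A).topologicalClosure) := by
    simp [opBinaryIndex, binaryIndex]
  rw [hb]
  constructor
  · rintro ⟨V, hVA, ⟨e⟩⟩
    have hV : CompleteSpace V := e.symm.isUniformEmbedding.isUniformInducing.completeSpace_congr
      e.symm.surjective |>.1 hR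
    have hV' : IsClosed (V : Set K) := (completeSpace_coe_iff_isComplete.1 hV).isClosed
    refine ⟨_, V, hVA, hV', ?_, rfl⟩
    have := lift_hilbertDim_eq_of_bijective (e : V →L[ℂ] (ran A).topologicalClosure) e.bijective
    rw [rangeIndex, lift_inj.1 this]
  · rintro ⟨_, V, hVA, hV, h, -⟩
    have := hV.completeSpace_coe
    obtain ⟨e⟩ := nonempty_linearIsometryEquiv_of_hilbertDim_eq (lift_inj.1 h)
    exact ⟨V, hVA, ⟨e.toContinuousLinearEquiv⟩⟩

/-- A closed subspace of the range with prescribed codimensions, under numerical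
compatibility conditions. -/
theorem exists_hasSplit_add_eq {a s₁ t₁ : Cardinal.{max u v}}
    (hH : nullity A + rangeIndex A = nullity A + icIndex A + a + s)
    (hK : corank A + rangeIndex A = corank A + icIndex A + a + s)
    (h₁ : HasSplit A s₁ t₁) (hs : s ≤ s₁) :
    ∃ t', HasSplit A s t' ∧ nullity A + t' = nullity A + icIndex A + a ∧
      corank A + t' = corank A + icIndex A + a := by
  obtain ⟨s₀, h₀⟩ := exists_hasSplit_icIndex A
  have hr := h₀.add_eq
  by_cases hle : s ≤ s₀
  · have key : ∀ n : Cardinal.{max u v}, n + rangeIndex A = n + icIndex A + a + s →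
        n + icIndex A + s₀ = n + icIndex A + a + s := fun n hn => by
      rw [← hn, ← hr, add_comm s₀, add_assoc]
    obtain ⟨b, hb, hn, hm⟩ := exists_add_eq_and_add_eq hle (key _ hH) (key _ hK)
    refine ⟨b + icIndex A, HasSplit.trim (hb ▸ h₀), ?_, ?_⟩
    · rw [← hn, add_comm b, add_assoc]
    · rw [← hm, add_comm b, add_assoc]
  -- A split with larger first part than `s₀` forces the index of incompleteness to be infinite and
  -- equal to `rangeIndex A`, so `t'` equals it too, and it absorbs `a` in both sums.
  · rw [not_le] at hle
    obtain ⟨b, rfl⟩ := exists_add_of_le hs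
    have h := h₁.trim
    set t' := b + t₁
    have ht := h.add_eq
    have hct := h.icIndex_le
    have hcinf : ℵ₀ ≤ icIndex A := by
      by_contra! hfin
      obtain ⟨d, hd⟩ := exists_add_of_le hct
      rw [← hr, hd, add_comm (icIndex A), ← add_assoc] at ht
      have := Cardinal.eq_of_add_eq_add_right ht hfin
      exact hle.not_ge (this ▸ self_le_add_right s d)
    have hs₀ : s₀ ≤ icIndex A := by
      by_contra! hlt
      rw [add_eq_left (hcinf.trans hlt.le) hlt.le] at hr
      exact hle.not_ge (hr ▸ ht ▸ self_le_add_right s t')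
    rw [add_eq_right hcinf hs₀] at hr
    have ht' : t' = icIndex A := le_antisymm (hr ▸ ht ▸ self_le_add_left t' s) hct
    have key : ∀ n : Cardinal.{max u v}, n + rangeIndex A = n + icIndex A + a + s →
        n + t' = n + icIndex A + a := fun n hn => by
      rw [← hr] at hn
      rw [ht']
      exact le_antisymm (self_le_add_right _ _) ((self_le_add_right _ s).trans hn.ge)
    exact ⟨t', h, key _ hH, key _ hK⟩

variable [CompleteSpace H]

theorem nullity_add_rangeIndex (A : H →L[ℂ] K) :
    nullity A + rangeIndex A = lift.{v} (hilbertDim H) := by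
  have h := hilbertDim_comap_orthogonal (A := A) (V := ⊥)
    (⊥ : Submodule ℂ K).closed_of_finiteDimensional bot_le
  rw [Submodule.bot_orthogonal_eq_top, top_inf_eq, Submodule.comap_top, hilbertDim_top] at h
  exact h.symm

/-- The range contains closed subspaces of every dimension below the range index. -/
theorem exists_hasSplit_of_lt {k : Cardinal.{max u v}} (hk : k < rangeIndex A) :
    ∃ s t, HasSplit A s t ∧ k < s := by
  by_contra! hno
  have hle : ∀ V ≤ ran A, IsClosed (V : Set K) → lift.{u} (hilbertDim V) ≤ k :=
    fun V hVA hV => hno _ _ ⟨V, hVA, hV, rfl, rfl⟩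
  by_cases hfd : FiniteDimensional ℂ (ran A)
  · have h1 := (ran A).closed_of_finiteDimensional
    have h2 := hle _ le_rfl h1
    rw [rangeIndex, h1.submodule_topologicalClosure_eq] at hk
    exact hk.not_ge h2
  rcases lt_or_ge k ℵ₀ with hfin | hinf
  · obtain ⟨n, rfl⟩ := lt_aleph0.1 hfin
    have hrank : ((n + 1 : ℕ) : Cardinal) ≤ Module.rank ℂ (ran A) :=
      natCast_le_aleph0.trans (not_lt.1 fun h => hfd (Module.rank_lt_aleph0_iff.1 h))
    obtain ⟨f, hf⟩ := Module.le_rank_iff_exists_linearMap.1 hrank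
    have hg : Function.Injective ((ran A).subtype ∘ₗ f) := Subtype.val_injective.comp hf
    have h1 := hle (LinearMap.range ((ran A).subtype ∘ₗ f))
      (by rintro _ ⟨x, rfl⟩; exact (f x).2) (Submodule.closed_of_finiteDimensional _)
    rw [hilbertDim_eq_finrank, LinearMap.finrank_range_of_inj hg] at h1
    simp at h1
  -- The cuts at 1/(n+1) have dimension at most `k`, and the images of their bases are total: if `y`
  -- is orthogonal to them all, then `A* y` lies in every `(X n)ᗮ`, so `A A* y = 0` and `A* y = 0`.
  -- Thus the range index is at most `k`.
  · have hX := fun n : ℕ => exists_isBoundedBelowOn_norm_le A (Nat.one_div_pos_of_nat (n := n))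
    choose X hXc hXb hXn using hX
    have := fun n => (hXc n).completeSpace_coe
    have hι := fun n => exists_hilbertBasis_type (E := X n)
    choose ι hι using hι
    let b := fun n => (hι n).some
    have hcard : ∀ n, lift.{v} #(ι n) ≤ k := fun n => by
      rw [mk_eq_hilbertDim (b n), ← lift_hilbertDim_map Nat.one_div_pos_of_nat (hXb n) (hXc n)]
      exact hle _ (map_le_ran A _) ((hXb n).isClosed_map Nat.one_div_pos_of_nat (hXc n))
    have hJ : lift.{v} #(Σ n, ι n) ≤ k := by
      rw [mk_sigma, lift_sum]
      refine (sum_le_sum _ (fun _ => k) hcard).trans ?_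
      rw [sum_const]
      simp [aleph0_mul_eq hinf]
    have := (ran A).isClosed_topologicalClosure.completeSpace_coe
    have hdim := lift_hilbertDim_le_of_total (F := (ran A).topologicalClosure)
      (fun j : Σ n, ι n => ⟨A (b j.1 j.2), (ran A).le_topologicalClosure (mem_ran A _)⟩) (by
      rintro ⟨y, hy⟩ h
      have hAy : ∀ n : ℕ, ‖A (A.adjoint y)‖ ≤ 1 / ((n : ℝ) + 1) * ‖A.adjoint y‖ := fun n =>
        hXn n _ (mem_orthogonal_hilbertBasis (b n) (hXc n) fun i => by
          rw [ContinuousLinearMap.adjoint_inner_right]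
          exact h ⟨n, i⟩)
      have h0 : A (A.adjoint y) = 0 := by
        have hlim := (tendsto_one_div_add_atTop_nhds_zero_nat (𝕜 := ℝ)).mul_const ‖A.adjoint y‖
        rw [zero_mul] at hlim
        exact norm_le_zero_iff.1 (ge_of_tendsto' hlim hAy)
      have h1 : A.adjoint y = 0 := by
        rw [← inner_self_eq_zero (𝕜 := ℂ), ContinuousLinearMap.adjoint_inner_left, h0,
          inner_zero_right]
      have h2 : y ∈ (ran A).topologicalClosureᗮ := by
        rw [Submodule.orthogonal_closure, Submodule.mem_orthogonal]
        rintro _ ⟨x, rfl⟩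
        change inner ℂ (A x) y = 0
        rw [← ContinuousLinearMap.adjoint_inner_right, h1, inner_zero_right]
      exact Subtype.ext (inner_self_eq_zero.1 ((Submodule.mem_orthogonal _ _).1 h2 y hy)))
    refine hk.not_ge (hdim.trans ?_)
    calc lift.{v} #(Σ n, ι n) * ℵ₀ ≤ k * ℵ₀ := by gcongr
      _ = k := mul_aleph0_eq hinf

/-- A split survives small perturbations of the operator. -/
theorem HasSplit.exists_of_norm_sub_lt (h : HasSplit A s t) :
    ∃ ε > 0, ∀ B : H →L[ℂ] K, ‖B - A‖ < ε → ∃ t', HasSplit B s t' ∧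
      nullity A + t = nullity B + t' ∧ corank A + t = corank B + t' := by
  obtain ⟨V, hVA, hV, rfl, rfl⟩ := h
  obtain ⟨X, c, hX, hc, hb, rfl⟩ := exists_isBoundedBelowOn hV hVA
  -- Radius c/2 leaves both operators bounded below by c/2 on `X`, still more than their distance.
  refine ⟨c / 2, half_pos hc, fun B hB => ?_⟩
  have hbB : IsBoundedBelowOn B X (c / 2) := by
    have := hb.of_norm_sub_le hB.le
    rwa [sub_half] at this
  have hbA : IsBoundedBelowOn A X (c / 2) := fun x hx =>
    (mul_le_mul_of_nonneg_right (half_le_self hc.le) (norm_nonneg x)).trans (hb x hx)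
  refine ⟨_, ⟨X.map (B : H →ₗ[ℂ] K), map_le_ran B X, hbB.isClosed_map (half_pos hc) hX, ?_, rfl⟩,
    ?_, ?_⟩
  · rw [lift_hilbertDim_map (half_pos hc) hbB hX, lift_hilbertDim_map hc hb hX]
  · rw [nullity, nullity, ← lift_hilbertDim_orthogonal (half_pos hc) hbB hX,
      ← lift_hilbertDim_orthogonal hc hb hX]
  · rw [corank, corank, ← lift_add, ← lift_add, ← hilbertDim_orthogonal_of_le_ran (map_le_ran B X),
      ← hilbertDim_orthogonal_of_le_ran (map_le_ran A X),
      hilbertDim_orthogonal_map_eq hbA hbB hX hB]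

end Splits

/-! ### Orbits, their invariants and their closures -/

section Orbits

variable {H : Type u} {K : Type v} [NormedAddCommGroup H] [InnerProductSpace ℂ H]
  [NormedAddCommGroup K] [InnerProductSpace ℂ K]

theorem mem_orbit_symm {A B : H →L[ℂ] K} (h : B ∈ orbit A) : A ∈ orbit B := by
  obtain ⟨L, G, rfl⟩ := h
  refine ⟨L.symm, G.symm, ?_⟩
  ext x
  simp

theorem ran_equiv_comp (A : H →L[ℂ] K) (L : H ≃L[ℂ] H) (G : K ≃L[ℂ] K) :
    ran ((G : K →L[ℂ] K) ∘L A ∘L (L.symm : H →L[ℂ] H)) =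
      (ran A).map ((G : K →L[ℂ] K) : K →ₗ[ℂ] K) := by
  ext y
  constructor
  · rintro ⟨x, rfl⟩
    exact ⟨A (L.symm x), mem_ran A _, rfl⟩
  · rintro ⟨_, ⟨x, rfl⟩, rfl⟩
    exact ⟨L x, by simp⟩

theorem topologicalClosure_map_equiv (G : K ≃L[ℂ] K) (V : Submodule ℂ K) :
    (V.map ((G : K →L[ℂ] K) : K →ₗ[ℂ] K)).topologicalClosure =
      V.topologicalClosure.map ((G : K →L[ℂ] K) : K →ₗ[ℂ] K) :=
  SetLike.coe_injective (G.toHomeomorph.image_closure V).symm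

theorem isClosed_map_equiv (G : K ≃L[ℂ] K) {V : Submodule ℂ K} (hV : IsClosed (V : Set K)) :
    IsClosed (V.map ((G : K →L[ℂ] K) : K →ₗ[ℂ] K) : Set K) := by
  rw [Submodule.map_coe]
  exact G.toHomeomorph.isClosedMap _ hV

/-- Isomorphisms of two closed subspaces and of their orthogonal complements glue. -/
theorem exists_equiv_of_orthogonal {V W : Submodule ℂ K} [CompleteSpace V] [CompleteSpace W]
    (e : V ≃L[ℂ] W) (f : Vᗮ ≃L[ℂ] Wᗮ) : ∃ G : K ≃L[ℂ] K, ∀ x, G x =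
      e (V.orthogonalProjectionOnto x) + f (Vᗮ.orthogonalProjectionOnto x) := by
  have key : ∀ {V W : Submodule ℂ K} [CompleteSpace V] [CompleteSpace W]
      (e : V ≃L[ℂ] W) (f : Vᗮ ≃L[ℂ] Wᗮ) (x : K),
      (e.symm (W.orthogonalProjectionOnto (e (V.orthogonalProjectionOnto x) +
        f (Vᗮ.orthogonalProjectionOnto x) : K)) : K) +
      f.symm (Wᗮ.orthogonalProjectionOnto (e (V.orthogonalProjectionOnto x) +
        f (Vᗮ.orthogonalProjectionOnto x) : K)) = x := by
    intro V W _ _ e f x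
    have h1 : Wᗮ.orthogonalProjectionOnto (e (V.orthogonalProjectionOnto x) : K) = 0 :=
      (Submodule.orthogonalProjectionOnto_eq_zero_iff).2
        (W.le_orthogonal_orthogonal (Subtype.coe_prop _))
    have h2 : W.orthogonalProjectionOnto (f (Vᗮ.orthogonalProjectionOnto x) : K) = 0 :=
      (Submodule.orthogonalProjectionOnto_eq_zero_iff).2 (Subtype.coe_prop _)
    rw [map_add W.orthogonalProjectionOnto, map_add Wᗮ.orthogonalProjectionOnto, h1, h2, add_zero,
      zero_add,
      Submodule.orthogonalProjectionOnto_mem_subspace_eq_self,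
      Submodule.orthogonalProjectionOnto_mem_subspace_eq_self, e.symm_apply_apply,
      f.symm_apply_apply]
    exact V.starProjection_add_starProjection_orthogonal x
  refine ⟨ContinuousLinearEquiv.equivOfInverse
    (W.subtypeL ∘L (e : V →L[ℂ] W) ∘L V.orthogonalProjectionOnto +
      Wᗮ.subtypeL ∘L (f : Vᗮ →L[ℂ] Wᗮ) ∘L Vᗮ.orthogonalProjectionOnto)
    (V.subtypeL ∘L (e.symm : W →L[ℂ] V) ∘L W.orthogonalProjectionOnto +
      Vᗮ.subtypeL ∘L (f.symm : Wᗮ →L[ℂ] Vᗮ) ∘L Wᗮ.orthogonalProjectionOnto)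
    (key e f) (key e.symm f.symm), fun x => rfl⟩

/-- Precomposing `A` with an orthogonal projection leads to an element of the closure of its
orbit. -/
theorem comp_starProjection_mem_closure_orbit (A : H →L[ℂ] K) {Y : Submodule ℂ H}
    [CompleteSpace Y] (L : H ≃L[ℂ] H) (G : K ≃L[ℂ] K) :
    (G : K →L[ℂ] K) ∘L A ∘L Y.starProjection ∘L (L.symm : H →L[ℂ] H) ∈ closure (orbit A) := by
  set M := (G : K →L[ℂ] K) ∘L A ∘L Y.starProjection ∘L (L.symm : H →L[ℂ] H)
  set N := (G : K →L[ℂ] K) ∘L A ∘L Yᗮ.starProjection ∘L (L.symm : H →L[ℂ] H)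
  -- `M + z • N` is `A` composed with the identity on `Y` and multiplication by `z` on `Yᗮ`, which
  -- is invertible for `z ≠ 0`.
  have hlim : Filter.Tendsto (fun z : ℂ => M + z • N) (nhdsWithin 0 {0}ᶜ) (nhds M) := by
    have : Continuous fun z : ℂ => M + z • N := by fun_prop
    have h := this.tendsto 0
    simp only [zero_smul, add_zero] at h
    exact h.mono_left nhdsWithin_le_nhds
  refine mem_closure_of_tendsto hlim ?_
  filter_upwards [self_mem_nhdsWithin] with z hz
  obtain ⟨D, hD⟩ := exists_equiv_of_orthogonal (ContinuousLinearEquiv.refl ℂ Y)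
    (ContinuousLinearEquiv.smulLeft (R₁ := ℂ) (M₁ := Yᗮ) (Units.mk0 z hz))
  refine ⟨(L.symm.trans D).symm, G, ?_⟩
  ext x
  have h1 : D (L.symm x) = Y.starProjection (L.symm x) + z • Yᗮ.starProjection (L.symm x) :=
    hD _
  change G (A _) + z • G (A _) = G (A (D (L.symm x)))
  rw [h1, map_add, map_add, map_smul, map_smul]
  rfl

variable [CompleteSpace K]

theorem hilbertDim_map_equiv (G : K ≃L[ℂ] K) {V : Submodule ℂ K} (hV : IsClosed (V : Set K)) :
    hilbertDim (V.map ((G : K →L[ℂ] K) : K →ₗ[ℂ] K)) = hilbertDim V := by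
  have := hV.completeSpace_coe
  have := (isClosed_map_equiv G hV).completeSpace_coe
  symm
  simpa using lift_hilbertDim_eq_of_bijective (mapRestrict (G : K →L[ℂ] K) V)
    ⟨fun x y hxy => Subtype.ext (G.injective (congrArg Subtype.val hxy)),
      by rintro ⟨_, x, hx, rfl⟩; exact ⟨⟨x, hx⟩, rfl⟩⟩

/-- `G` need not preserve orthogonality, but following it by the projection to `Wᗮ` stays injective:
`G x ∈ G V` puts `x` in `V ⊓ Vᗮ`. Applying this to `G.symm` gives equality. -/
theorem hilbertDim_inf_orthogonal_le_map (G : K ≃L[ℂ] K) {U V : Submodule ℂ K}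
    (hU : IsClosed (U : Set K)) (hV : IsClosed (V : Set K)) (hVU : V ≤ U) :
    hilbertDim ↥(Vᗮ ⊓ U) ≤ hilbertDim ↥((V.map ((G : K →L[ℂ] K) : K →ₗ[ℂ] K))ᗮ ⊓
      U.map ((G : K →L[ℂ] K) : K →ₗ[ℂ] K)) := by
  set W := V.map ((G : K →L[ℂ] K) : K →ₗ[ℂ] K)
  set Y := U.map ((G : K →L[ℂ] K) : K →ₗ[ℂ] K)
  have hW : IsClosed (W : Set K) := isClosed_map_equiv G hV
  have hWY : W ≤ Y := Submodule.map_mono hVU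
  have := hW.completeSpace_coe
  have := (isClosed_inf_orthogonal V hU).completeSpace_coe
  have := (isClosed_inf_orthogonal W (isClosed_map_equiv G hU)).completeSpace_coe
  let T : ↥(Vᗮ ⊓ U) →L[ℂ] ↥(Wᗮ ⊓ Y) :=
    (Wᗮ.starProjection ∘L (G : K →L[ℂ] K) ∘L (Vᗮ ⊓ U).subtypeL).codRestrict _ fun x => by
      refine ⟨Submodule.starProjection_apply_mem _ _, ?_⟩
      change Wᗮ.starProjection (G x) ∈ Y
      rw [Submodule.starProjection_orthogonal_val]
      exact Y.sub_mem ⟨x, x.2.2, rfl⟩ (hWY (Submodule.starProjection_apply_mem _ _))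
  have key := lift_hilbertDim_le_of_injective T (by
    rw [injective_iff_map_eq_zero]
    intro x hx
    have h1 : Wᗮ.starProjection (G x) = 0 := congrArg Subtype.val hx
    rw [Submodule.starProjection_apply_eq_zero_iff, Submodule.orthogonal_orthogonal] at h1
    obtain ⟨y, hy, hyx⟩ := h1
    have hyx' : y = x := G.injective hyx
    rw [hyx'] at hy
    exact Subtype.ext (inner_self_eq_zero.1 ((Submodule.mem_orthogonal _ _).1 x.2.1 x hy)))
  simpa using key

theorem hilbertDim_inf_orthogonal_map (G : K ≃L[ℂ] K) {U V : Submodule ℂ K}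
    (hU : IsClosed (U : Set K)) (hV : IsClosed (V : Set K)) (hVU : V ≤ U) :
    hilbertDim ↥((V.map ((G : K →L[ℂ] K) : K →ₗ[ℂ] K))ᗮ ⊓
      U.map ((G : K →L[ℂ] K) : K →ₗ[ℂ] K)) = hilbertDim ↥(Vᗮ ⊓ U) := by
  refine le_antisymm ?_ (hilbertDim_inf_orthogonal_le_map G hU hV hVU)
  have h := hilbertDim_inf_orthogonal_le_map G.symm (isClosed_map_equiv G hU)
    (isClosed_map_equiv G hV) (Submodule.map_mono hVU)
  have hmap : ∀ V : Submodule ℂ K, (V.map ((G : K →L[ℂ] K) : K →ₗ[ℂ] K)).map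
      ((G.symm : K →L[ℂ] K) : K →ₗ[ℂ] K) = V := fun V => by
    ext x
    simp
  rwa [hmap, hmap] at h

theorem nullity_eq_of_mem_orbit {H : Type u} [NormedAddCommGroup H]
    [InnerProductSpace ℂ H] [CompleteSpace H] {K : Type v} [NormedAddCommGroup K]
    [InnerProductSpace ℂ K] {A B : H →L[ℂ] K} (h : B ∈ orbit A) :
    nullity B = nullity A := by
  obtain ⟨L, G, rfl⟩ := h
  have : nul ((G : K →L[ℂ] K) ∘L A ∘L (L.symm : H →L[ℂ] H)) =
      (nul A).map ((L : H →L[ℂ] H) : H →ₗ[ℂ] H) := by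
    ext x
    constructor
    · intro hx
      have hx' : G (A (L.symm x)) = 0 := hx
      exact ⟨L.symm x, G.map_eq_zero_iff.1 hx', by simp⟩
    · rintro ⟨y, hy, rfl⟩
      have hy' : A y = 0 := hy
      change G (A (L.symm (L y))) = 0
      simp [hy']
  rw [nullity, nullity, this, hilbertDim_map_equiv L (isClosed_nul A)]

theorem corank_eq_of_mem_orbit {A B : H →L[ℂ] K} (h : B ∈ orbit A) : corank B = corank A := by
  obtain ⟨L, G, rfl⟩ := h
  have h1 := hilbertDim_inf_orthogonal_map G (U := ⊤) isClosed_univ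
    (ran A).isClosed_topologicalClosure le_top
  have h2 : (⊤ : Submodule ℂ K).map ((G : K →L[ℂ] K) : K →ₗ[ℂ] K) = ⊤ := by
    rw [Submodule.map_top, LinearMap.range_eq_top]
    exact G.surjective
  rw [h2, inf_top_eq, inf_top_eq, ← topologicalClosure_map_equiv, ← ran_equiv_comp A L G] at h1
  rw [corank, corank, h1]

theorem HasSplit.of_mem_orbit {A B : H →L[ℂ] K} {s t : Cardinal.{max u v}} (h : HasSplit A s t)
    (hB : B ∈ orbit A) : HasSplit B s t := by
  obtain ⟨L, G, rfl⟩ := hB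
  obtain ⟨V, hVA, hV, rfl, rfl⟩ := h
  refine ⟨V.map ((G : K →L[ℂ] K) : K →ₗ[ℂ] K), ?_, isClosed_map_equiv G hV, ?_, ?_⟩
  · rw [ran_equiv_comp]
    exact Submodule.map_mono hVA
  · rw [hilbertDim_map_equiv G hV]
  · rw [ran_equiv_comp, topologicalClosure_map_equiv,
      hilbertDim_inf_orthogonal_map G (ran A).isClosed_topologicalClosure hV
        (hVA.trans (ran A).le_topologicalClosure)]

variable [CompleteSpace H]

/-- Operators near `C` in the closure of the orbit of every `A` with a matching split. -/
theorem exists_hasSplit_mem_closure_orbit (C : H →L[ℂ] K) {ε : ℝ} (hε : 0 < ε) :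
    ∃ s t, HasSplit C s t ∧ ∀ (A : H →L[ℂ] K) (t' : Cardinal.{max u v}), HasSplit A s t' →
      nullity A + t' = nullity C + t → corank A + t' = corank C + t →
      ∃ B ∈ closure (orbit A), ‖B - C‖ ≤ ε := by
  obtain ⟨X, hX, hXb, hXn⟩ := exists_isBoundedBelowOn_norm_le C hε
  have hVc := hXb.isClosed_map hε hX
  have := hX.completeSpace_coe
  refine ⟨_, _, ⟨X.map (C : H →ₗ[ℂ] K), map_le_ran C X, hVc, rfl, rfl⟩, ?_⟩
  rintro A _ ⟨W, hWA, hW, hs, rfl⟩ hnull hcor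
  obtain ⟨Y, c, hY, hc, hYb, rfl⟩ := exists_isBoundedBelowOn hW hWA
  have := hY.completeSpace_coe
  have := hVc.completeSpace_coe
  have := hW.completeSpace_coe
  -- The numerical hypotheses become equalities of dimension between `Y` and `X`, between their
  -- complements, and between the complements of `A Y` and `C X`.
  rw [lift_hilbertDim_map hε hXb hX, lift_hilbertDim_map hc hYb hY, lift_inj] at hs
  rw [nullity, nullity, ← lift_hilbertDim_orthogonal hc hYb hY,
    ← lift_hilbertDim_orthogonal hε hXb hX, lift_inj] at hnull
  rw [corank, corank, ← lift_add, ← lift_add, ← hilbertDim_orthogonal_of_le_ran (map_le_ran A Y),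
    ← hilbertDim_orthogonal_of_le_ran (map_le_ran C X), lift_inj] at hcor
  obtain ⟨e⟩ := nonempty_linearIsometryEquiv_of_hilbertDim_eq hs
  obtain ⟨e'⟩ := nonempty_linearIsometryEquiv_of_hilbertDim_eq hnull
  obtain ⟨f⟩ := nonempty_linearIsometryEquiv_of_hilbertDim_eq hcor
  have hbA := hYb.bijective_mapRestrict hc
  have hbC := hXb.bijective_mapRestrict hε
  let a := ContinuousLinearEquiv.ofBijective (mapRestrict A Y) (LinearMap.ker_eq_bot.2 hbA.1)
    (LinearMap.range_eq_top.2 hbA.2)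
  let b := ContinuousLinearEquiv.ofBijective (mapRestrict C X) (LinearMap.ker_eq_bot.2 hbC.1)
    (LinearMap.range_eq_top.2 hbC.2)
  obtain ⟨L, hL⟩ := exists_equiv_of_orthogonal e.toContinuousLinearEquiv e'.toContinuousLinearEquiv
  -- On `A Y`, `G` inverts `A`, applies `e`, then `C`, so that `G A = C e` on `Y`.
  obtain ⟨G, hG⟩ := exists_equiv_of_orthogonal
    ((a.symm.trans e.toContinuousLinearEquiv).trans b) f.toContinuousLinearEquiv
  have hmem := comp_starProjection_mem_closure_orbit A (Y := Y) L G
  have hGA : ∀ y : Y, G (A y) = C (e y) := fun y => by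
    have h1 : (Y.map (A : H →ₗ[ℂ] K)).orthogonalProjectionOnto (A y) = a y :=
      Submodule.orthogonalProjectionOnto_mem_subspace_eq_self (a y)
    have h2 : (Y.map (A : H →ₗ[ℂ] K))ᗮ.orthogonalProjectionOnto (A y) = 0 :=
      (Submodule.orthogonalProjectionOnto_eq_zero_iff).2
        (Submodule.le_orthogonal_orthogonal _ (a y).2)
    rw [hG, h1, h2, map_zero]
    simp only [ContinuousLinearEquiv.trans_apply, a.symm_apply_apply, ZeroMemClass.coe_zero,
      add_zero]
    rfl
  have hXL : ∀ x, X.starProjection x = e (Y.orthogonalProjectionOnto (L.symm x)) := fun x => by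
    have h1 := hL (L.symm x)
    rw [L.apply_symm_apply] at h1
    refine Submodule.eq_starProjection_of_mem_orthogonal (Subtype.coe_prop _) ?_
    have h2 : x - e (Y.orthogonalProjectionOnto (L.symm x)) =
        e' (Yᗮ.orthogonalProjectionOnto (L.symm x)) := sub_eq_of_eq_add' h1
    rw [h2]
    exact Subtype.coe_prop _
  have heq : (G : K →L[ℂ] K) ∘L A ∘L Y.starProjection ∘L (L.symm : H →L[ℂ] H) =
      C ∘L X.starProjection := by
    ext x
    change G (A (Y.orthogonalProjectionOnto (L.symm x))) = C (X.starProjection x)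
    rw [hGA, hXL]
  rw [heq] at hmem
  refine ⟨_, hmem, ContinuousLinearMap.opNorm_le_bound _ hε.le fun x => ?_⟩
  have h1 : (C ∘L X.starProjection - C) x = - C (Xᗮ.starProjection x) := by
    rw [Submodule.starProjection_orthogonal_val, map_sub, neg_sub]
    rfl
  rw [h1, norm_neg]
  exact (hXn _ (Submodule.starProjection_apply_mem _ _)).trans
    (mul_le_mul_of_nonneg_left (Submodule.norm_starProjection_apply_le _ _) hε.le)

/-- The operators in the norm closure of the orbit of `A`. -/
theorem mem_closure_orbit_iff {A C : H →L[ℂ] K} : C ∈ closure (orbit A) ↔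
    rangeIndex C ≤ rangeIndex A ∧
    (opBinaryIndex A = 0 ∧ opBinaryIndex C = 1 → rangeIndex C < rangeIndex A) ∧
    ∃ α : Cardinal.{max u v}, initialIndex C = initialIndex A + α ∧
      finalIndex C = finalIndex A + α := by
  have hi : ∀ B : H →L[ℂ] K, initialIndex B = nullity B + icIndex B := fun _ => rfl
  have hf : ∀ B : H →L[ℂ] K, finalIndex B = corank B + icIndex B := fun _ => rfl
  simp only [hi, hf]
  refine ⟨fun hC => ?_, ?_⟩
  · have near : ∀ s t, HasSplit C s t → ∃ t', HasSplit A s t' ∧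
        nullity C + t = nullity A + t' ∧ corank C + t = corank A + t' := by
      intro s t h
      obtain ⟨ε, hε, h⟩ := h.exists_of_norm_sub_lt
      obtain ⟨B, hB, hBC⟩ := Metric.mem_closure_iff.1 hC ε hε
      obtain ⟨t', hs, hn, hc⟩ := h B (by rwa [dist_comm, dist_eq_norm] at hBC)
      rw [nullity_eq_of_mem_orbit hB] at hn
      rw [corank_eq_of_mem_orbit hB] at hc
      exact ⟨t', hs.of_mem_orbit (mem_orbit_symm hB), hn, hc⟩
    have hr : rangeIndex C ≤ rangeIndex A := by
      by_contra! hlt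
      obtain ⟨s, t, hst, hlts⟩ := exists_hasSplit_of_lt hlt
      obtain ⟨t', h', -⟩ := near s t hst
      exact hlts.not_ge (h'.add_eq ▸ self_le_add_right s t')
    refine ⟨hr, fun ⟨hbA, hbC⟩ => hr.lt_of_ne fun heq => ?_, ?_⟩
    · obtain ⟨t, ht⟩ := opBinaryIndex_eq_one_iff.1 hbC
      obtain ⟨t', h', -⟩ := near _ t ht
      rw [heq] at h'
      exact opBinaryIndex_eq_zero_iff.1 hbA (opBinaryIndex_eq_one_iff.2 ⟨t', h'⟩)
    · obtain ⟨s, hs⟩ := exists_hasSplit_icIndex C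
      obtain ⟨t', h', hn, hc⟩ := near s _ hs
      obtain ⟨a, rfl⟩ := exists_add_of_le h'.icIndex_le
      exact ⟨a, by rw [hn, add_assoc], by rw [hc, add_assoc]⟩
  · rintro ⟨ha, hb, α, hα, hα'⟩
    rw [Metric.mem_closure_iff]
    intro ε hε
    obtain ⟨s, t, hst, happ⟩ := exists_hasSplit_mem_closure_orbit C (half_pos (half_pos hε))
    obtain ⟨d, rfl⟩ := exists_add_of_le hst.icIndex_le
    have hr := hst.add_eq
    have hsr : s ≤ rangeIndex C := hr ▸ self_le_add_right s _
    -- Only `s = rangeIndex A` is delicate: then `C` has a split of full size, and (b) rules out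
    -- binary index 0 for `A`.
    have hlarge : ∃ s₁ t₁, HasSplit A s₁ t₁ ∧ s ≤ s₁ := by
      rcases (hsr.trans ha).lt_or_eq with hlt | heq
      · obtain ⟨s₁, t₁, h, hlt⟩ := exists_hasSplit_of_lt hlt
        exact ⟨s₁, t₁, h, hlt.le⟩
      · have hsC : s = rangeIndex C := le_antisymm hsr (heq ▸ ha)
        by_cases hbA : opBinaryIndex A = 1
        · obtain ⟨t₁, h⟩ := opBinaryIndex_eq_one_iff.1 hbA
          exact ⟨_, t₁, h, heq.le⟩
        · have hbC : opBinaryIndex C = 1 := opBinaryIndex_eq_one_iff.2 ⟨_, hsC ▸ hst⟩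
          have := hb ⟨opBinaryIndex_eq_zero_iff.2 hbA, hbC⟩
          exact absurd (hsC.symm.trans heq) this.ne
    obtain ⟨s₁, t₁, h₁, hs₁⟩ := hlarge
    -- The cut of `C` exceeds the index of incompleteness of `C` by `d`, so the excess required over
    -- that of `A` is `α + d`.
    obtain ⟨t', ht', hn, hc⟩ := exists_hasSplit_add_eq (A := A) (a := α + d) (s := s)
      (by rw [nullity_add_rangeIndex, ← nullity_add_rangeIndex C, ← hr,
            ← add_assoc (nullity A + icIndex A) α d, ← hα]
          ac_rfl)
      (by rw [corank_add_rangeIndex, ← corank_add_rangeIndex C, ← hr,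
            ← add_assoc (corank A + icIndex A) α d, ← hα']
          ac_rfl) h₁ hs₁
    obtain ⟨B, hB, hBC⟩ := happ A t' ht' (by rw [hn, ← add_assoc, ← hα, add_assoc])
      (by rw [hc, ← add_assoc, ← hα', add_assoc])
    obtain ⟨D, hD, hBD⟩ := Metric.mem_closure_iff.1 hB (ε / 2) (half_pos hε)
    refine ⟨D, hD, ?_⟩
    calc dist C D ≤ dist C B + dist B D := dist_triangle _ _ _
      _ = ‖B - C‖ + dist B D := by rw [dist_comm, dist_eq_norm]
      _ < ε := by linarith

/-- The cardinal α is the dimension of a closed subspace of the range that attains the index of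
incompleteness; together with each index it fills up the whole space. -/
theorem exists_hilbertDim_eq_index_add (A : H →L[ℂ] K) : ∃ α : Cardinal.{max u v},
    lift.{v} (hilbertDim H) = initialIndex A + α ∧
    lift.{u} (hilbertDim K) = finalIndex A + α := by
  have hi : ∀ B : H →L[ℂ] K, initialIndex B = nullity B + icIndex B := fun _ => rfl
  have hf : ∀ B : H →L[ℂ] K, finalIndex B = corank B + icIndex B := fun _ => rfl
  obtain ⟨s, hs⟩ := exists_hasSplit_icIndex A
  have hr := hs.add_eq
  refine ⟨s, ?_, ?_⟩
  · rw [hi, ← nullity_add_rangeIndex A, ← hr]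
    ac_rfl
  · rw [hf, ← corank_add_rangeIndex A, ← hr]
    ac_rfl

end Orbits

end HilbertOrbit

theorem mainTheorem1 {H : Type u} {K : Type v}
    [NormedAddCommGroup H] [InnerProductSpace ℂ H] [CompleteSpace H]
    [NormedAddCommGroup K] [InnerProductSpace ℂ K] [CompleteSpace K]
    (A : H →L[ℂ] K) :
    (∀ C : H →L[ℂ] K, C ∈ closure (HilbertOrbit.orbit A) ↔
      HilbertOrbit.rangeIndex C ≤ HilbertOrbit.rangeIndex A ∧
      (HilbertOrbit.opBinaryIndex A = 0 ∧ HilbertOrbit.opBinaryIndex C = 1 →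
        HilbertOrbit.rangeIndex C < HilbertOrbit.rangeIndex A) ∧
      ∃ α : Cardinal.{max u v},
        HilbertOrbit.initialIndex C = HilbertOrbit.initialIndex A + α ∧
        HilbertOrbit.finalIndex C = HilbertOrbit.finalIndex A + α) ∧
    (∀ C : H →L[ℂ] K,
      HilbertOrbit.initialIndex C = Cardinal.lift.{v} (HilbertOrbit.hilbertDim H) →
      HilbertOrbit.finalIndex C = Cardinal.lift.{u} (HilbertOrbit.hilbertDim K) →
      ∃ α : Cardinal.{max u v},
        HilbertOrbit.initialIndex C = HilbertOrbit.initialIndex A + α ∧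
        HilbertOrbit.finalIndex C = HilbertOrbit.finalIndex A + α) :=
  ⟨fun _ => HilbertOrbit.mem_closure_orbit_iff, fun C h₁ h₂ => by
    rw [h₁, h₂]
    exact HilbertOrbit.exists_hilbertDim_eq_index_add A⟩
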